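/- Let $n\ge 0$, let $\delta=(n,n-1,\dots,1)$, let $\lambda$ be a partition of length $\ell(\lambda)\le n$, padded with zeros to $n$ parts, and let $\mu=\lambda+\delta$, a strict partition of length $n$. The Young diagram $F^\lambda$ has left-adjusted rows of lengths $\lambda_1,\lambda_2,\dots$. The shifted diagram $SF^\mu=\{(i,j):1\le i\le n,\ i\le j<i+\mu_i\}$ has rows of lengths $\mu_1,\dots,\mu_n$, left-adjusted to the main diagonal; cells are written (row, column). Order the letters by $1'<1<2'<2<\cdots<n'<n$ and define the following sets. - $\mathcal{QST}^\mu(n)$: the fillings of $SF^\mu$ with these letters that increase weakly along rows from left to right and down columns, with no two identical unprimed letters in any column and no two identical primed letters in any row. $\mathcal{PST}^\mu(n)$ is the subset of those with no primed letter on the main diagonal. - $\mathcal{QD}^\delta(n)$: the fillings of $SF^\delta$ with these letters in which each unprimed $k$ appears only in row $k$ and each primed $k'$ only in column $k$. $\mathcal{PD}^\delta(n)$ is the subset of those with no primed letter on the main diagonal. - $\mathcal T^\lambda(n)$: the semistandard tableaux of shape $F^\lambda$ with entries in $\{1,\dots,n\}$ (weakly increasing along rows, strictly increasing down columns). The weight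 of a filling of a shifted diagram is $(u_1,\dots,u_n/v_1,\dots,v_n)$, where $u_k$ and $v_k$ are the numbers of $k$'s and of $k'$'s in it. The weight of $T\in\mathcal T^\lambda(n)$ is $(w_1,\dots,w_n/0,\dots,0)$, where $w_k$ is the number of $k$'s in $T$. For $k=1,\dots,n$ let $\theta_{k'}$ be the following operation: take the letters $k'$ in turn from top to bottom, and slide each by successive interchanges with a neighbour until it stays. Let $b$ be its northern and $d$ its western neighbour. As long as $k'$ is to the right of column $k$, it is interchanged with $b$ if $b\ge d$ and with $d$ if $b<d$; in the topmost row it is interchanged with $d$. When $k'$ is in column $k$, in row $i$, it is interchanged with $b$ if $b$ exists, is unprimed and $b\ge i$; otherwise it stays. Then there is a map $$\Theta:\ \mathcal{QST}^\mu(n)\to\mathcal{QD}^\delta(n)\times\mathcal T^\lambda(n)$$ such that, writing $\Theta(S)=(D,T)$ for $S\in\mathcal{QST}^\mu(n)$: 1. the filling $\theta_{n'}\circ\cdots\circ\theta_{2'}\circ\theta_{1'}(S)$ of $SF^\mu$ is the juxtaposition of $D$ (columns $1,\dots,n$) and $T$ (columns $n+1,n+2,\dots$), which determines $\Theta$; 2.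 $\mathrm{wgt}(S)=\mathrm{wgt}(D)+\mathrm{wgt}(T)$; 3. $\Theta$ is a bijection; 4. $\Theta$ restricts to a bijection from $\mathcal{PST}^\mu(n)$ onto $\mathcal{PD}^\delta(n)\times\mathcal T^\lambda(n)$. -/

import Mathlib

/-!
Primed shifted tableaux, triangular tableaux, and the jeu de taquin map between them.

All indices start from `0`: rows, columns and letters are numbered `0, 1, …, n - 1` instead of
`1, 2, …, n`. Cells are pairs `(row, column)`, with rows numbered downwards.
-/

namespace ShiftedTableaux

/-- The letters `k'` (primed) and `k` (unprimed). -/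
inductive Letter : Type
  | primed (k : ℕ) : Letter
  | unprimed (k : ℕ) : Letter

namespace Letter

/-- The number of a letter, regardless of primes. -/
def index : Letter → ℕ
  | primed k => k
  | unprimed k => k

/-- The position of a letter in the list `0' < 0 < 1' < 1 < 2' < 2 < ⋯`. -/
def rank : Letter → ℕ
  | primed k => 2 * k
  | unprimed k => 2 * k + 1

theorem rank_injective : Function.Injective rank := by
  intro x y h
  cases x <;> cases y <;> simp only [rank] at h <;> first | omega | (congr 1; omega)

/-- The total order `0' < 0 < 1' < 1 < 2' < 2 < ⋯` on letters. -/
instance : LinearOrder Letter := LinearOrder.lift' rank rank_injective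

end Letter

/-- A filling of a set of cells with letters; the value is `none` off that set. -/
abbrev Filling : Type := ℕ × ℕ → Option Letter

/-- The shifted diagram with row lengths `mu 0, mu 1, …`, row `i` being indented by `i` cells. -/
def shiftedDiagram (mu : ℕ → ℕ) : Set (ℕ × ℕ) :=
  {c | c.1 ≤ c.2 ∧ c.2 < c.1 + mu c.1}

/-- The staircase `δ = (n, n - 1, …, 1)`. -/
def delta (n : ℕ) : ℕ → ℕ := fun i => n - i

/-- `F` is a filling of the shifted diagram of `mu` with letters `k, k'` for `k < n`. -/
structure IsShiftedFilling (n : ℕ) (mu : ℕ → ℕ) (F : Filling) : Prop where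
  shape : ∀ c, (F c).isSome ↔ c ∈ shiftedDiagram mu
  bound : ∀ c x, F c = some x → x.index < n

/-- Primed shifted tableaux of shape `mu`, primes being allowed on the main diagonal. -/
structure IsQST (n : ℕ) (mu : ℕ → ℕ) (F : Filling) : Prop extends IsShiftedFilling n mu F where
  row_weak : ∀ i j₁ j₂ x y, j₁ < j₂ → F (i, j₁) = some x → F (i, j₂) = some y → x ≤ y
  col_weak : ∀ i₁ i₂ j x y, i₁ < i₂ → F (i₁, j) = some x → F (i₂, j) = some y → x ≤ y
  col_unprimed : ∀ i₁ i₂ j k, F (i₁, j) = some (.unprimed k) → F (i₂, j) = some (.unprimed k) →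
    i₁ = i₂
  row_primed : ∀ i j₁ j₂ k, F (i, j₁) = some (.primed k) → F (i, j₂) = some (.primed k) →
    j₁ = j₂

/-- There are no primed letters on the main diagonal. -/
def UnprimedDiagonal (F : Filling) : Prop := ∀ i k, F (i, i) ≠ some (.primed k)

/-- Triangular tableaux: each `k` sits in row `k` and each `k'` in column `k`; primes are allowed
on the main diagonal. -/
structure IsQD (n : ℕ) (F : Filling) : Prop extends IsShiftedFilling n (delta n) F where
  unprimed_row : ∀ i j k, F (i, j) = some (.unprimed k) → i = k
  primed_col : ∀ i j k, F (i, j) = some (.primed k) → j = k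

/-- The set `QST^mu(n)`. -/
def QST (n : ℕ) (mu : ℕ → ℕ) : Set Filling := {F | IsQST n mu F}

/-- The set `PST^mu(n)`. -/
def PST (n : ℕ) (mu : ℕ → ℕ) : Set Filling := {F | IsQST n mu F ∧ UnprimedDiagonal F}

/-- The set `QD^δ(n)`. -/
def QD (n : ℕ) : Set Filling := {F | IsQD n F}

/-- The set `PD^δ(n)`. -/
def PD (n : ℕ) : Set Filling := {F | IsQD n F ∧ UnprimedDiagonal F}

/-- The set `T^lam(n)` of semistandard tableaux of shape `lam` with `n` letters. -/
def SST (n : ℕ) (lam : YoungDiagram) : Set (SemistandardYoungTableau lam) :=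
  {T | ∀ c ∈ lam.cells, T c.1 c.2 < n}

/-- The weight `(u / v)`: `u k` and `v k` are the numbers of `k`'s and of `k'`'s. -/
noncomputable def wgt (n : ℕ) (F : Filling) : (Fin n → ℕ) × (Fin n → ℕ) :=
  (fun k => {c | F c = some (.unprimed k)}.ncard, fun k => {c | F c = some (.primed k)}.ncard)

/-- The weight of a semistandard tableau: `w k` is the number of `k`'s. -/
def wgtSST (n : ℕ) {lam : YoungDiagram} (T : SemistandardYoungTableau lam) : Fin n → ℕ :=
  fun k => (lam.cells.filter fun c => T c.1 c.2 = k).card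

/-- The cell to which the letter `k'` standing in the given cell of `F` moves next, or `none` if
it stays.

To the right of column `k`, compare the northern neighbour `b` with the western neighbour `d`:
the letter `k'` moves north if `b ≥ d` and west if `b < d`; in the topmost row it moves west.
In column `k`, it moves north if it is in row `i` and its northern neighbour is an unprimed
`b ≥ i`, and it stays otherwise. -/
def nextCell (k : ℕ) (F : Filling) : ℕ × ℕ → Option (ℕ × ℕ)
  | (0, j) =>
    if k < j then
      match F (0, j - 1) with
      | some (.unprimed _) => some (0, j - 1)
      | _ => none
    else none
  | (i + 1, j) =>
    if k < j then
      match F (i, j), F (i + 1, j - 1) with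
      | some (.unprimed b), some (.unprimed d) => if d ≤ b then some (i, j) else some (i + 1, j - 1)
      | _, _ => none
    else
      match F (i, j) with
      | some (.unprimed b) => if i + 1 ≤ b then some (i, j) else none
      | _ => none

/-- One move: the letter `k'` in the current cell is interchanged with the letter in the next
cell, which becomes the current cell. Nothing changes if `k'` stays. -/
def move (k : ℕ) (s : Filling × (ℕ × ℕ)) : Filling × (ℕ × ℕ) :=
  match nextCell k s.1 s.2 with
  | some c => (s.1 ∘ Equiv.swap s.2 c, c)
  | none => s

/-- Slide the letter `k'` in cell `c` of `F` until it stays. Each move lowers the sum of the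
coordinates of the current cell by one, so `c.1 + c.2` moves suffice. -/
def slide (k : ℕ) (F : Filling) (c : ℕ × ℕ) : Filling :=
  ((move k)^[c.1 + c.2] (F, c)).1

open Classical in
/-- Slide the letter `k'` in row `i`, if there is one. -/
noncomputable def slideRow (k : ℕ) (F : Filling) (i : ℕ) : Filling :=
  if h : ∃ j, F (i, j) = some (.primed k) then slide k F (i, Nat.find h) else F

/-- The map `θ_{k'}`: slide the letters `k'` in turn from top to bottom. -/
noncomputable def theta (n k : ℕ) (F : Filling) : Filling :=
  (List.range n).foldl (slideRow k) F

/-- The composite `θ_{(n-1)'} ∘ ⋯ ∘ θ_{1'} ∘ θ_{0'}`. -/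
noncomputable def jeuDeTaquin (n : ℕ) (F : Filling) : Filling :=
  (List.range n).foldl (fun G k => theta n k G) F

/-- The filling obtained by placing the tableau `T` to the right of the triangular tableau `D`,
row by row, starting in column `n`. -/
def juxtapose (n : ℕ) {lam : YoungDiagram} (D : Filling) (T : SemistandardYoungTableau lam) :
    Filling := fun c =>
  if c.2 < n then D c
  else if (c.1, c.2 - n) ∈ lam then some (.unprimed (T c.1 (c.2 - n)))
  else none

end ShiftedTableaux

open ShiftedTableaux

/-!
The map is analysed one letter `k'` at a time. Let `IsStage n mu k` be the set of fillings whose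
columns before column `k` satisfy the conditions of triangular tableaux, and whose columns from `k`
on satisfy those of primed shifted tableaux without letters less than `k'`. For `k = 0` these are
the primed shifted tableaux; for `k = n` they are the juxtapositions of a triangular and a
semistandard tableau. So it suffices that `theta n k` maps stage `k` bijectively onto stage `k + 1`
(`theta_bijOn`). Weights are preserved because every move permutes cells, and the diagonal is
never changed, because `(k, k)` is the only diagonal cell in which a letter `k'` can be when it
slides, and it stays there.

From column `k` on, row `i` of a filling at stage `k` has only letters of index at least `i`, and
a diagonal letter there has index exactly `i`. Hence the letters at most `k'` from column `k` on
fill a left-justified shape (`slideRegion`) contained in the rows `0, …, k`. The unprimed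
letters in it form a semistandard tableau, and the letters `k'` a vertical strip at its border.
The process is jeu de taquin on this shape with the letters `k'` as holes.

A single move keeps the array semistandard apart from the hole, and it is undone by the backward
move, which interchanges the hole with the lesser of its southern and eastern neighbours; conversely
forward moves undo backward ones. These are the lemmas `Sliding.north`, `Sliding.west`,
`Sliding.south` and `Sliding.east`. It has to be shown too that the paths of successive holes do not
cross. For this the states carry a lattice path `p` between two successive holes with
`a (p j - 1) (j + 1) < a (p j) j` in each column `j`: this inequality prevents a hole below from
moving up through the path, and a hole above from moving back down through it. A hole that passes
a column boundary satisfies it on either side of its own path, so that it is available for the next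
hole in both directions.

A hole that has reached column `k` rises as long as the letter above it is unprimed and at least
the row number of the hole. Strict increase in columns then forces every unprimed letter above the
lowest hole at rest to equal its row number. When all holes are at rest, this holds for all unprimed
letters less than `k` in the column.

Injectivity of `theta n k` holds because the backward slides, from the lowest letter `k'` in column
`k` to the highest, are determined by the result (`SlidesBack.unique`). It is surjective because
every filling at stage `k + 1` can be slid back, and the forward slides then return it
(`IsSettled.exists_foldl_eq`).
-/

namespace ShiftedTableaux

/-! ### Moves of a hole in an array -/

section

/-- The region in which the letters `k'` slide: the cells `(i, j)` with `Z i j` form a bounded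
Young-diagram shape whose leftmost column is column `k`. Rows `0, …, k - 1` are nonempty, and no
row lies below row `k`. -/
structure IsSlideShape (k : ℕ) (Z : ℕ → ℕ → Prop) : Prop where
  closed : ∀ i j i' j', Z i j → i' ≤ i → k ≤ j' → j' ≤ j → Z i' j'
  le_col : ∀ i j, Z i j → k ≤ j
  row_le : ∀ i j, Z i j → i ≤ k
  full : ∀ i, i < k → Z i k
  bdd : ∃ B, ∀ i j, Z i j → j < B

/-- The array `a` with a hole at `(x, y)` in the middle of a slide.

Here `a i j` is the unprimed letter in cell `(i, j)` if it is less than `k`, and `k` otherwise, so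
that `k` plays the part of `∞`; a *hole* is a cell of the region `Z` with entry `k`, that is, a
letter `k'`. The holes of the rows `i < I`, except for the moving one, are at rest in column `k`, in
rows less than `r`.

The function `p` is a lattice path, crossing from column `j` to column `j + 1` in row `p j`. In the
columns `j < y` it runs above the moving hole, and in the columns `y ≤ j < c` below it. In a forward
slide, the first part separates the hole from the path of the previous hole and the second part
records its own path; in a backward slide the parts are exchanged. Both are described by the same
inequality `sep`, so a single function serves. -/
structure Sliding (k r I c : ℕ) (p : ℕ → ℕ) (Z : ℕ → ℕ → Prop) (a : ℕ → ℕ → ℕ) (x y : ℕ) :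
    Prop where
  le : ∀ i j, a i j ≤ k
  off : ∀ i j, k ≤ j → ¬ Z i j → a i j = k
  lower : ∀ i j, k ≤ j → i ≤ k → i ≤ a i j
  /-- Column `k` is in its final form above row `r`: the letter in row `i` is `i` or `k'`. -/
  final : ∀ i, i < r → a i k = i ∨ a i k = k
  /-- Rows increase weakly, apart from the moving hole and the cells of `final`. -/
  row : ∀ i j₁ j₂, k ≤ j₁ → j₁ < j₂ → ¬ (j₁ = k ∧ i < r) → ¬ (i = x ∧ j₁ = y) →
    ¬ (i = x ∧ j₂ = y) → a i j₁ ≤ a i j₂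
  /-- Columns increase strictly as long as the entries are less than `k`, with the same
  exceptions. -/
  col : ∀ i₁ i₂ j, k ≤ j → i₁ < i₂ → ¬ (j = k ∧ i₁ < r) → ¬ (i₁ = x ∧ j = y) →
    ¬ (i₂ = x ∧ j = y) → a i₁ j < a i₂ j ∨ a i₂ j = k
  mem : Z x y
  hole : a x y = k
  le_row : r ≤ x
  row_lt : x < I
  holes : ∀ i j, Z i j → a i j = k → (i = x ∧ j = y) ∨ (j = k ∧ i < r) ∨ I ≤ i
  /-- The rows from `I` on have at most one hole each. -/
  single : ∀ i j₁ j₂, I ≤ i → Z i j₁ → Z i j₂ → a i j₁ = k → a i j₂ = k → j₁ = j₂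
  /-- In the rows from `I` on, no letter less than `k` stands in column `c` or to its right. -/
  tail : ∀ i j, I ≤ i → c ≤ j → k ≤ j → a i j = k
  mono : ∀ j₁ j₂, k ≤ j₁ → j₁ ≤ j₂ → (j₂ < y ∨ j₂ < c) → p j₁ ≤ p j₂
  upper : ∀ j, k ≤ j → j < y → r ≤ p j ∧ p j ≤ x
  below : ∀ j, y ≤ j → j < c → x < p j ∧ p j ≤ I
  /-- A hole in row `p j - 1` of column `j` must leave it eastwards when it slides back, and a hole
  in row `p j` of column `j + 1` must leave it westwards when it slides forward. The value
  `p j = 0`, which allows the empty separator above row `0`, forces `r = 0`. -/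
  sep : ∀ j, k ≤ j → (j < y ∨ j < c) → p j = 0 ∨ a (p j - 1) (j + 1) < a (p j) j

variable {k r I c : ℕ} {p : ℕ → ℕ} {Z : ℕ → ℕ → Prop} {a a' : ℕ → ℕ → ℕ} {x y : ℕ}

theorem Sliding.lt_of_mem (H : Sliding k r I c p Z a x y) {i j : ℕ} (h : Z i j) (hi : i < I)
    (h₁ : ¬ (j = k ∧ i < r)) (h₂ : ¬ (i = x ∧ j = y)) : a i j < k := by
  have := H.le i j
  have := H.holes i j h
  omega

/-- A move north, allowed if the northern neighbour is at least the western one (or, in column `k`,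
at least the row number). The last conclusion says that sliding back undoes the move. -/
theorem Sliding.north (hZ : IsSlideShape k Z) (H : Sliding k r I c p Z a (x + 1) y)
    (h₁ : a' (x + 1) y = a x y) (h₂ : a' x y = k)
    (h₃ : ∀ i j, ¬ (i = x + 1 ∧ j = y) → ¬ (i = x ∧ j = y) → a' i j = a i j)
    (hr : y = k → r ≤ x) (hW : k < y → a (x + 1) (y - 1) ≤ a x y)
    (hb : y = k → x + 1 ≤ a x y) : Sliding k r I c p Z a' x y ∧ a' (x + 1) y ≤ a' x (y + 1) := by
  have hky := hZ.le_col _ _ H.mem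
  have hxk := hZ.row_le _ _ H.mem
  have hN : Z x y := hZ.closed _ _ x y H.mem (by omega) hky le_rfl
  have hlt := H.row_lt
  have hNlt : a x y < k := H.lt_of_mem hN (by omega) (by omega) (by omega)
  have hlow : x + 1 ≤ a x y := by
    rcases hky.eq_or_lt with h | h
    · exact hb h.symm
    · exact (H.lower (x + 1) (y - 1) (by omega) hxk).trans (hW h)
  -- the separator leaves room for the move north
  have hp : k < y → p (y - 1) ≤ x := by
    intro h
    have h1 := H.upper (y - 1) (by omega) (by omega)
    have h2 := H.sep (y - 1) (by omega) (by omega)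
    by_contra h3
    have h4 : p (y - 1) = x + 1 := by omega
    rw [h4, Nat.sub_add_cancel (by omega : 1 ≤ y)] at h2
    have := hW h
    simp at h2
    omega
  refine ⟨{ le := ?_, off := ?_, lower := ?_, final := ?_, row := ?_, col := ?_, mem := hN,
            hole := h₂, le_row := ?_, row_lt := by omega, holes := ?_, single := ?_, tail := ?_,
            mono := ?_, upper := ?_, below := ?_, sep := ?_ }, ?_⟩
  · intro i j
    have := H.le i j
    have := h₃ i j
    by_cases e : i = x + 1 ∧ j = y
    · rw [e.1, e.2]; omega
    by_cases e' : i = x ∧ j = y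
    · rw [e'.1, e'.2]; omega
    omega
  · intro i j hj hz
    rw [h₃ i j, H.off i j hj hz]
    · rintro ⟨rfl, rfl⟩; exact hz H.mem
    · rintro ⟨rfl, rfl⟩; exact hz hN
  · intro i j hj hi
    have := H.lower i j hj hi
    have := h₃ i j
    by_cases e : i = x + 1 ∧ j = y
    · rw [e.1, e.2]; omega
    by_cases e' : i = x ∧ j = y
    · rw [e'.1, e'.2]; omega
    omega
  · intro i hi
    have := H.le_row
    have := H.final i hi
    rw [h₃ i k (by omega) (by intro h; have := hr h.2.symm; omega)]
    exact this
  · intro i j₁ j₂ hj hjj hr1 hh1 hh2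
    by_cases e : i = x + 1 ∧ j₁ = y
    · obtain ⟨rfl, rfl⟩ := e
      rw [h₁, h₃ _ j₂ (by omega) (by omega)]
      have := H.row x j₁ j₂ hj hjj (by omega) (by omega) (by omega)
      have := H.col x (x+1) j₂ (by omega) (by omega) (by omega) (by omega) (by omega)
      omega
    by_cases e' : i = x + 1 ∧ j₂ = y
    · obtain ⟨rfl, rfl⟩ := e'
      rw [h₁, h₃ _ j₁ (by omega) (by omega)]
      have := hW (by omega)
      by_cases e2 : j₁ = j₂ - 1
      · rw [e2]; exact this
      · have := H.row (x+1) j₁ (j₂ - 1) hj (by omega) (by omega) (by omega) (by omega)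
        omega
    rw [h₃ _ _ e hh1, h₃ _ _ e' hh2]
    exact H.row i j₁ j₂ hj hjj hr1 e e'
  · intro i₁ i₂ j hj hii hr1 hh1 hh2
    by_cases e : i₁ = x + 1 ∧ j = y
    · obtain ⟨rfl, rfl⟩ := e
      rw [h₁, h₃ _ _ (by omega) (by omega)]
      exact H.col x i₂ j hj (by omega) (by omega) (by omega) (by omega)
    by_cases e' : i₂ = x + 1 ∧ j = y
    · obtain ⟨rfl, rfl⟩ := e'
      rw [h₁, h₃ _ _ (by omega) (by omega)]
      exact H.col i₁ x j hj (by omega) (by omega) (by omega) (by omega)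
    rw [h₃ _ _ e hh1, h₃ _ _ e' hh2]
    exact H.col i₁ i₂ j hj hii hr1 e e'
  · rcases hky.eq_or_lt with h | h
    · exact hr h.symm
    · exact (H.upper (y - 1) (by omega) (by omega)).1.trans (hp h)
  · intro i j hz ha
    by_cases e : i = x ∧ j = y
    · exact Or.inl e
    by_cases e' : i = x + 1 ∧ j = y
    · rw [e'.1, e'.2] at ha; omega
    rw [h₃ i j e' e] at ha
    have := H.holes i j hz ha
    omega
  · intro i j₁ j₂ hi z₁ z₂
    rw [h₃ i j₁ (by omega) (by omega), h₃ i j₂ (by omega) (by omega)]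
    exact H.single i j₁ j₂ hi z₁ z₂
  · intro i j hi
    rw [h₃ i j (by omega) (by omega)]
    exact H.tail i j hi
  · exact H.mono
  · intro j hj hjy
    have := H.upper j hj hjy
    have := hp (by omega)
    have := H.mono j (y - 1) hj (by omega) (by omega)
    omega
  · intro j hj hjc
    have := H.below j hj hjc
    omega
  · intro j hj hjj
    have h0 := H.sep j hj hjj
    rcases lt_or_ge j y with h | h
    · have := hp (by omega)
      have := H.mono j (y - 1) hj (by omega) (by omega)
      by_cases h0' : p j = 0
      · exact Or.inl h0'
      rw [h₃ _ _ (by omega) (by omega), h₃ _ _ (by omega) (by omega)]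
      exact h0
    · have := H.below j h (by omega)
      rw [h₃ _ _ (by omega) (by omega), h₃ _ _ (by omega) (by omega)]
      exact h0
  · rw [h₁, h₃ _ _ (by omega) (by omega)]
    exact H.row x y (y+1) hky (by omega) (by omega) (by omega) (by omega)

/-- A move west, allowed if the northern neighbour is less than the western one. The hole passes
below its predecessor's path in column `y`, and its own crossing row is recorded in `p y` as
`x + 1`. The last conclusion says that sliding back undoes the move. -/
theorem Sliding.west (hZ : IsSlideShape k Z) (H : Sliding k r I c p Z a x (y + 1)) (hky : k ≤ y)
    (h₁ : a' x (y + 1) = a x y) (h₂ : a' x y = k)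
    (h₃ : ∀ i j, ¬ (i = x ∧ j = y + 1) → ¬ (i = x ∧ j = y) → a' i j = a i j)
    (hN : x = 0 ∨ a (x - 1) (y + 1) < a x y) :
    Sliding k r I c (Function.update p y (x + 1)) Z a' x y ∧
      a' x (y + 1) < a' (x + 1) y := by
  have hW : Z x y := hZ.closed _ _ x y H.mem le_rfl hky (by omega)
  have hlt := H.row_lt
  have hxk := hZ.row_le _ _ H.mem
  have hp := H.upper y hky (by omega)
  have hWlt : a x y < k := H.lt_of_mem hW (by omega) (by omega) (by omega)
  have hS : a x y < a (x + 1) y := by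
    have := H.col x (x + 1) y hky (by omega) (by omega) (by omega) (by omega)
    omega
  refine ⟨{ le := ?_, off := ?_, lower := ?_, final := ?_, row := ?_, col := ?_, mem := hW,
            hole := h₂, le_row := by omega, row_lt := by omega, holes := ?_, single := ?_, tail := ?_,
            mono := ?_, upper := ?_, below := ?_, sep := ?_ }, ?_⟩
  · intro i j
    have := H.le i j
    have := h₃ i j
    by_cases e : i = x ∧ j = y + 1
    · rw [e.1, e.2]; omega
    by_cases e' : i = x ∧ j = y
    · rw [e'.1, e'.2]; omega
    omega
  · intro i j hj hz
    rw [h₃ i j, H.off i j hj hz]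
    · rintro ⟨rfl, rfl⟩; exact hz H.mem
    · rintro ⟨rfl, rfl⟩; exact hz hW
  · intro i j hj hi
    have := H.lower i j hj hi
    have := h₃ i j
    by_cases e : i = x ∧ j = y + 1
    · rw [e.1, e.2, h₁]; exact H.lower x y hky hxk
    by_cases e' : i = x ∧ j = y
    · rw [e'.1, e'.2]; omega
    omega
  · intro i hi
    have := H.final i hi
    rw [h₃ i k (by omega) (by omega)]
    exact this
  · intro i j₁ j₂ hj hjj hr1 hh1 hh2
    by_cases e : i = x ∧ j₁ = y + 1
    · obtain ⟨rfl, rfl⟩ := e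
      rw [h₁, h₃ _ j₂ (by omega) (by omega)]
      exact H.row i y j₂ hky (by omega) (by omega) (by omega) (by omega)
    by_cases e' : i = x ∧ j₂ = y + 1
    · obtain ⟨rfl, rfl⟩ := e'
      rw [h₁, h₃ _ j₁ (by omega) (by omega)]
      exact H.row i j₁ y hj (by omega) (by omega) (by omega) (by omega)
    rw [h₃ _ _ e hh1, h₃ _ _ e' hh2]
    exact H.row i j₁ j₂ hj hjj hr1 e e'
  · intro i₁ i₂ j hj hii hr1 hh1 hh2
    by_cases e : i₁ = x ∧ j = y + 1
    · obtain ⟨rfl, rfl⟩ := e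
      rw [h₁, h₃ _ _ (by omega) (by omega)]
      have := H.col i₁ i₂ y hky (by omega) (by omega) (by omega) (by omega)
      have := H.row i₂ y (y+1) hky (by omega) (by omega) (by omega) (by omega)
      have := H.le i₂ (y+1)
      omega
    by_cases e' : i₂ = x ∧ j = y + 1
    · obtain ⟨rfl, rfl⟩ := e'
      rw [h₁, h₃ _ _ (by omega) (by omega)]
      by_cases e2 : i₁ = i₂ - 1
      · rw [e2]; omega
      · have := H.col i₁ (i₂ - 1) (y+1) hj (by omega) (by omega) (by omega) (by omega)
        omega
    rw [h₃ _ _ e hh1, h₃ _ _ e' hh2]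
    exact H.col i₁ i₂ j hj hii hr1 e e'
  · intro i j hz ha
    by_cases e : i = x ∧ j = y
    · exact Or.inl e
    by_cases e' : i = x ∧ j = y + 1
    · rw [e'.1, e'.2] at ha; omega
    rw [h₃ i j e' e] at ha
    have := H.holes i j hz ha
    omega
  · intro i j₁ j₂ hi z₁ z₂
    rw [h₃ i j₁ (by omega) (by omega), h₃ i j₂ (by omega) (by omega)]
    exact H.single i j₁ j₂ hi z₁ z₂
  · intro i j hi
    rw [h₃ i j (by omega) (by omega)]
    exact H.tail i j hi
  · intro j₁ j₂ hj hjj hj2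
    simp only [Function.update_apply]
    have := H.mono j₁ j₂ hj hjj (by omega)
    have := H.upper j₁ hj
    have := H.below j₂
    split_ifs <;> omega
  · intro j hj hjy
    rw [Function.update_of_ne (by omega)]
    exact H.upper j hj (by omega)
  · intro j hj hjc
    rcases eq_or_ne j y with rfl | h
    · simp; omega
    · rw [Function.update_of_ne h]
      exact H.below j (by omega) hjc
  · intro j hj hjj
    rcases eq_or_ne j y with rfl | h
    · right
      rw [Function.update_self, Nat.add_sub_cancel, h₁, h₃ _ _ (by omega) (by omega)]
      exact hS
    · rw [Function.update_of_ne h]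
      have h0 := H.sep j hj (by omega)
      have h5 := H.upper j hj
      have h6 := H.below j
      by_cases h0' : p j = 0
      · exact Or.inl h0'
      rw [h₃ _ _ (by omega) (by omega), h₃ _ _ (by omega) (by omega)]
      exact h0
  · rw [h₁, h₃ _ _ (by omega) (by omega)]
    exact hS

/-- A backward move south, allowed if the southern neighbour is at most the eastern one. The last
two conclusions say that sliding forward undoes the move. -/
theorem Sliding.south (hZ : IsSlideShape k Z) (H : Sliding k r I c p Z a x y)
    (h₁ : a' x y = a (x + 1) y) (h₂ : a' (x + 1) y = k)
    (h₃ : ∀ i j, ¬ (i = x ∧ j = y) → ¬ (i = x + 1 ∧ j = y) → a' i j = a i j)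
    (hS : a (x + 1) y < k) (hE : a (x + 1) y ≤ a x (y + 1)) :
    Sliding k r I c p Z a' (x + 1) y ∧ (k < y → a' (x + 1) (y - 1) ≤ a' x y) ∧
      x + 1 ≤ a' x y := by
  have hky := hZ.le_col _ _ H.mem
  have hSZ : Z (x + 1) y := by
    by_contra h
    have := H.off _ _ hky h
    omega
  have hxk := hZ.row_le _ _ hSZ
  have hr := H.le_row
  -- a small southern neighbour in row `I` would contradict the separator, or lie beyond column `c`
  have hlt : x + 1 < I := by
    by_contra h
    rcases lt_or_ge y c with hc | hc
    · have := H.below y le_rfl hc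
      have h2 := H.sep y hky (by omega)
      have e : p y = x + 1 := by omega
      rw [e] at h2
      simp at h2
      omega
    · have := H.tail (x + 1) y (by omega) hc hky
      omega
  -- the separator leaves room for the move south
  have hp : y < c → x + 1 < p y := by
    intro h
    have h1 := H.below y le_rfl h
    have h2 := H.sep y hky (by omega)
    by_contra h3
    have h4 : p y = x + 1 := by omega
    rw [h4] at h2
    simp at h2
    omega
  have hlow := H.lower (x + 1) y hky hxk
  refine ⟨{ le := ?_, off := ?_, lower := ?_, final := ?_, row := ?_, col := ?_, mem := hSZ,
            hole := h₂, le_row := by omega, row_lt := hlt, holes := ?_, single := ?_, tail := ?_,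
            mono := ?_, upper := ?_, below := ?_, sep := ?_ }, ?_, ?_⟩
  · intro i j
    have := H.le i j
    have := h₃ i j
    by_cases e : i = x + 1 ∧ j = y
    · rw [e.1, e.2]; omega
    by_cases e' : i = x ∧ j = y
    · rw [e'.1, e'.2]; omega
    omega
  · intro i j hj hz
    rw [h₃ i j, H.off i j hj hz]
    · rintro ⟨rfl, rfl⟩; exact hz H.mem
    · rintro ⟨rfl, rfl⟩; exact hz hSZ
  · intro i j hj hi
    have := H.lower i j hj hi
    have := h₃ i j
    by_cases e : i = x + 1 ∧ j = y
    · rw [e.1, e.2]; omega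
    by_cases e' : i = x ∧ j = y
    · rw [e'.1, e'.2]; omega
    omega
  · intro i hi
    have := H.final i hi
    rw [h₃ i k (by omega) (by omega)]
    exact this
  · intro i j₁ j₂ hj hjj hr1 hh1 hh2
    by_cases e : i = x ∧ j₁ = y
    · obtain ⟨rfl, rfl⟩ := e
      rw [h₁, h₃ _ j₂ (by omega) (by omega)]
      by_cases e2 : j₂ = j₁ + 1
      · rw [e2]; exact hE
      · have := H.row i (j₁ + 1) j₂ (by omega) (by omega) (by omega) (by omega) (by omega)
        omega
    by_cases e' : i = x ∧ j₂ = y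
    · obtain ⟨rfl, rfl⟩ := e'
      rw [h₁, h₃ _ j₁ (by omega) (by omega)]
      have := H.col i (i+1) j₁ hj (by omega) (by omega) (by omega) (by omega)
      have := H.row (i+1) j₁ j₂ hj (by omega) (by omega) (by omega) (by omega)
      omega
    rw [h₃ _ _ e hh1, h₃ _ _ e' hh2]
    exact H.row i j₁ j₂ hj hjj hr1 e e'
  · intro i₁ i₂ j hj hii hr1 hh1 hh2
    by_cases e : i₁ = x ∧ j = y
    · obtain ⟨rfl, rfl⟩ := e
      rw [h₁, h₃ _ _ (by omega) (by omega)]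
      exact H.col (i₁ + 1) i₂ j hj (by omega) (by omega) (by omega) (by omega)
    by_cases e' : i₂ = x ∧ j = y
    · obtain ⟨rfl, rfl⟩ := e'
      rw [h₁, h₃ _ _ (by omega) (by omega)]
      exact H.col i₁ (i₂ + 1) j hj (by omega) (by omega) (by omega) (by omega)
    rw [h₃ _ _ e hh1, h₃ _ _ e' hh2]
    exact H.col i₁ i₂ j hj hii hr1 e e'
  · intro i j hz ha
    by_cases e : i = x + 1 ∧ j = y
    · exact Or.inl e
    by_cases e' : i = x ∧ j = y
    · rw [e'.1, e'.2] at ha; omega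
    rw [h₃ i j e' e] at ha
    have := H.holes i j hz ha
    omega
  · intro i j₁ j₂ hi z₁ z₂
    rw [h₃ i j₁ (by omega) (by omega), h₃ i j₂ (by omega) (by omega)]
    exact H.single i j₁ j₂ hi z₁ z₂
  · intro i j hi
    rw [h₃ i j (by omega) (by omega)]
    exact H.tail i j hi
  · exact H.mono
  · intro j hj hjy
    have := H.upper j hj hjy
    omega
  · intro j hj hjc
    have := H.below j hj hjc
    have := hp (by omega)
    have := H.mono y j hky hj (by omega)
    omega
  · intro j hj hjj
    have h0 := H.sep j hj hjj
    rcases lt_or_ge j y with h | h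
    · have := H.upper j hj h
      by_cases h0' : p j = 0
      · exact Or.inl h0'
      rw [h₃ _ _ (by omega) (by omega), h₃ _ _ (by omega) (by omega)]
      exact h0
    · have := hp (by omega)
      have := H.mono y j hky h (by omega)
      rw [h₃ _ _ (by omega) (by omega), h₃ _ _ (by omega) (by omega)]
      exact h0
  · intro h
    rw [h₁, h₃ _ _ (by omega) (by omega)]
    exact H.row (x + 1) (y - 1) y (by omega) (by omega) (by omega) (by omega) (by omega)
  · omega

/-- A backward move east, allowed if the eastern neighbour is less than the southern one; the
crossing row is recorded in `p y` as `x`. The last conclusion says that sliding forward undoes the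
move. -/
theorem Sliding.east (hZ : IsSlideShape k Z) (H : Sliding k r I c p Z a x y)
    (h₁ : a' x y = a x (y + 1)) (h₂ : a' x (y + 1) = k)
    (h₃ : ∀ i j, ¬ (i = x ∧ j = y) → ¬ (i = x ∧ j = y + 1) → a' i j = a i j)
    (hE : a x (y + 1) < k) (hS : a x (y + 1) < a (x + 1) y) :
    Sliding k r I c (Function.update p y x) Z a' x (y + 1) ∧
      (x = 0 ∨ a' (x - 1) (y + 1) < a' x y) := by
  have hky := hZ.le_col _ _ H.mem
  have hEZ : Z x (y + 1) := by
    by_contra h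
    have := H.off x (y + 1) (by omega) h
    omega
  have hlt := H.row_lt
  have hxk := hZ.row_le _ _ H.mem
  have hr := H.le_row
  have hN : x = 0 ∨ a (x - 1) (y + 1) < a x (y + 1) := by
    rcases Nat.eq_zero_or_pos x with h | h
    · exact Or.inl h
    · have := H.col (x - 1) x (y + 1) (by omega) (by omega) (by omega) (by omega) (by omega)
      omega
  refine ⟨{ le := ?_, off := ?_, lower := ?_, final := ?_, row := ?_, col := ?_, mem := hEZ,
            hole := h₂, le_row := by omega, row_lt := by omega, holes := ?_, single := ?_, tail := ?_,
            mono := ?_, upper := ?_, below := ?_, sep := ?_ }, ?_⟩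
  · intro i j
    have := H.le i j
    have := h₃ i j
    by_cases e : i = x ∧ j = y + 1
    · rw [e.1, e.2]; omega
    by_cases e' : i = x ∧ j = y
    · rw [e'.1, e'.2]; omega
    omega
  · intro i j hj hz
    rw [h₃ i j, H.off i j hj hz]
    · rintro ⟨rfl, rfl⟩; exact hz H.mem
    · rintro ⟨rfl, rfl⟩; exact hz hEZ
  · intro i j hj hi
    have := H.lower i j hj hi
    have := h₃ i j
    by_cases e : i = x ∧ j = y + 1
    · rw [e.1, e.2, h₂]; omega
    by_cases e' : i = x ∧ j = y
    · rw [e'.1, e'.2, h₁]; exact H.lower x (y + 1) (by omega) hxk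
    omega
  · intro i hi
    have := H.final i hi
    rw [h₃ i k (by omega) (by omega)]
    exact this
  · intro i j₁ j₂ hj hjj hr1 hh1 hh2
    by_cases e : i = x ∧ j₁ = y
    · obtain ⟨rfl, rfl⟩ := e
      rw [h₁, h₃ _ j₂ (by omega) (by omega)]
      exact H.row i (j₁ + 1) j₂ (by omega) (by omega) (by omega) (by omega) (by omega)
    by_cases e' : i = x ∧ j₂ = y
    · obtain ⟨rfl, rfl⟩ := e'
      rw [h₁, h₃ _ j₁ (by omega) (by omega)]
      exact H.row i j₁ (j₂ + 1) hj (by omega) (by omega) (by omega) (by omega)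
    rw [h₃ _ _ e hh1, h₃ _ _ e' hh2]
    exact H.row i j₁ j₂ hj hjj hr1 e e'
  · intro i₁ i₂ j hj hii hr1 hh1 hh2
    by_cases e : i₁ = x ∧ j = y
    · obtain ⟨rfl, rfl⟩ := e
      rw [h₁, h₃ _ _ (by omega) (by omega)]
      by_cases e2 : i₂ = i₁ + 1
      · rw [e2]; omega
      · have := H.col (i₁ + 1) i₂ j hj (by omega) (by omega) (by omega) (by omega)
        omega
    by_cases e' : i₂ = x ∧ j = y
    · obtain ⟨rfl, rfl⟩ := e'
      rw [h₁, h₃ _ _ (by omega) (by omega)]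
      have := H.col i₁ i₂ (j + 1) (by omega) (by omega) (by omega) (by omega) (by omega)
      have := H.row i₁ j (j+1) hj (by omega) (by omega) (by omega) (by omega)
      omega
    rw [h₃ _ _ e hh1, h₃ _ _ e' hh2]
    exact H.col i₁ i₂ j hj hii hr1 e e'
  · intro i j hz ha
    by_cases e : i = x ∧ j = y + 1
    · exact Or.inl e
    by_cases e' : i = x ∧ j = y
    · rw [e'.1, e'.2] at ha; omega
    rw [h₃ i j e' e] at ha
    have := H.holes i j hz ha
    omega
  · intro i j₁ j₂ hi z₁ z₂
    rw [h₃ i j₁ (by omega) (by omega), h₃ i j₂ (by omega) (by omega)]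
    exact H.single i j₁ j₂ hi z₁ z₂
  · intro i j hi
    rw [h₃ i j (by omega) (by omega)]
    exact H.tail i j hi
  · intro j₁ j₂ hj hjj hj2
    simp only [Function.update_apply]
    have := H.upper j₁ hj
    have := H.below j₂
    have := H.mono j₁ j₂ hj hjj
    split_ifs <;> omega
  · intro j hj hjy
    rcases eq_or_ne j y with rfl | h
    · simp; omega
    · rw [Function.update_of_ne h]
      exact H.upper j hj (by omega)
  · intro j hj hjc
    rw [Function.update_of_ne (by omega)]
    exact H.below j (by omega) hjc
  · intro j hj hjj
    rcases eq_or_ne j y with rfl | h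
    · rw [Function.update_self, h₁]
      by_cases h0 : x = 0
      · exact Or.inl h0
      rw [h₃ _ _ (by omega) (by omega)]
      exact hN
    · rw [Function.update_of_ne h]
      have h0 := H.sep j hj (by omega)
      have h5 := H.upper j hj
      have h6 := H.below j
      by_cases h0' : p j = 0
      · exact Or.inl h0'
      rw [h₃ _ _ (by omega) (by omega), h₃ _ _ (by omega) (by omega)]
      exact h0
  · by_cases h0 : x = 0
    · exact Or.inl h0
    rw [h₁, h₃ _ _ (by omega) (by omega)]
    exact hN

end

/-! ### Beginning and end of a slide -/

section

/-- The array `a` between two slides: the holes of the rows `i < I` have come to rest in column `k`,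
in rows less than `r`, and the rows `i ≥ I` are untouched. The conventions are those of `Sliding`;
the path `p` separates the last hole that has come to rest from the next one to move. For `r = 0`
there is nothing to separate, and `p = 0` will do. -/
structure Settled (k r I : ℕ) (Z : ℕ → ℕ → Prop) (a : ℕ → ℕ → ℕ) : Prop where
  le : ∀ i j, a i j ≤ k
  off : ∀ i j, k ≤ j → ¬ Z i j → a i j = k
  lower : ∀ i j, k ≤ j → i ≤ k → i ≤ a i j
  final : ∀ i, i < r → a i k = i ∨ a i k = k
  row : ∀ i j₁ j₂, k ≤ j₁ → j₁ < j₂ → ¬ (j₁ = k ∧ i < r) → a i j₁ ≤ a i j₂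
  col : ∀ i₁ i₂ j, k ≤ j → i₁ < i₂ → ¬ (j = k ∧ i₁ < r) → a i₁ j < a i₂ j ∨ a i₂ j = k
  le_row : r ≤ I
  holes : ∀ i j, Z i j → a i j = k → (j = k ∧ i < r) ∨ I ≤ i
  single : ∀ i j₁ j₂, I ≤ i → Z i j₁ → Z i j₂ → a i j₁ = k → a i j₂ = k → j₁ = j₂
  separated : ∃ (c : ℕ) (p : ℕ → ℕ), k ≤ c ∧ (∀ i, I ≤ i → a i c = k) ∧
    (∀ j₁ j₂, k ≤ j₁ → j₁ ≤ j₂ → j₂ < c → p j₁ ≤ p j₂) ∧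
    (∀ j, k ≤ j → j < c → r ≤ p j ∧ p j ≤ I) ∧
    ∀ j, k ≤ j → j < c → p j = 0 ∨ a (p j - 1) (j + 1) < a (p j) j

variable {k r I c : ℕ} {p : ℕ → ℕ} {Z : ℕ → ℕ → Prop} {a : ℕ → ℕ → ℕ} {x y : ℕ}

/-- The hole in row `I` starts to slide; no backward move is possible from its starting cell. -/
theorem Settled.start (hZ : IsSlideShape k Z) (H : Settled k r I Z a) (hz : Z I y)
    (ha : a I y = k) :
    (∃ p, Sliding k r (I + 1) y p Z a I y) ∧ a (I + 1) y = k ∧ a I (y + 1) = k := by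
  obtain ⟨c, p, hkc, hc, hmono, hp, hsep⟩ := H.separated
  have hle := H.le_row
  have hky := hZ.le_col _ _ hz
  have hyc : y ≤ c := by
    by_contra h
    have := H.single I c y le_rfl (hZ.closed _ _ _ _ hz le_rfl hkc (by omega)) hz (hc _ le_rfl) ha
    omega
  have hk : ∀ i j, I ≤ i → y ≤ j → a i j = k := by
    intro i j hi hj
    have h1 : a i y = k := by
      rcases hi.eq_or_lt with rfl | h
      · exact ha
      · have := H.col I i y hky h (by omega)
        have := H.le i y
        omega
    rcases hj.eq_or_lt with rfl | h
    · exact h1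
    · have := H.row i y j hky h (by omega)
      have := H.le i j
      omega
  refine ⟨⟨p, H.le, H.off, H.lower, H.final, ?_, ?_, hz, ha, hle, by omega, ?_, ?_, ?_, ?_, ?_, ?_,
    ?_⟩, hk _ _ (by omega) le_rfl, hk _ _ le_rfl (by omega)⟩
  · intro i j₁ j₂ h1 h2 h3 _ _
    exact H.row i j₁ j₂ h1 h2 h3
  · intro i j₁ j₂ h1 h2 h3 _ _
    exact H.col i j₁ j₂ h1 h2 h3
  · intro i j h1 h2
    rcases H.holes i j h1 h2 with h | h
    · exact Or.inr (Or.inl h)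
    · rcases h.eq_or_lt with rfl | h
      · exact Or.inl ⟨rfl, H.single _ _ _ le_rfl h1 hz h2 ha⟩
      · exact Or.inr (Or.inr h)
  · intro i j₁ j₂ hi
    exact H.single i j₁ j₂ (by omega)
  · intro i j hi hj _
    exact hk i j (by omega) hj
  · intro j₁ j₂ h1 h2 h3
    exact hmono j₁ j₂ h1 h2 (by omega)
  · intro j h1 h2
    exact hp j h1 (by omega)
  · intro j h1 h2
    omega
  · intro j h1 h2
    exact hsep j h1 (by omega)

/-- A hole comes to rest in row `x` of column `k` when the letter above it is less than `x`. This
forces the letters in the rows `r, …, x - 1` of that column to equal their row numbers. -/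
theorem Sliding.settled_of_forward (hZ : IsSlideShape k Z) (H : Sliding k r I c p Z a x k)
    (hx : r < x → a (x - 1) k < x) : Settled k (x + 1) I Z a := by
  have hr := H.le_row
  have hxI := H.row_lt
  have hxk := hZ.row_le _ _ H.mem
  have key : ∀ d i, r ≤ i → i + d + 1 = x → a i k = i := by
    intro d
    induction d with
    | zero =>
      intro i h1 h2
      have h3 := hx (by omega)
      rw [show x - 1 = i by omega] at h3
      have := H.lower i k le_rfl (by omega)
      omega
    | succ d ih =>
      intro i h1 h2
      have h3 := ih (i + 1) (by omega) (by omega)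
      have := H.col i (i + 1) k le_rfl (by omega) (by omega) (by omega) (by omega)
      have := H.lower i k le_rfl (by omega)
      omega
  refine ⟨H.le, H.off, H.lower, ?_, ?_, ?_, by omega, ?_, H.single, max c k, p, by omega, ?_, ?_,
    ?_, ?_⟩
  · intro i hi
    rcases lt_or_ge i r with h | h
    · exact H.final i h
    rcases Nat.lt_succ_iff_lt_or_eq.1 hi with h' | rfl
    · exact Or.inl (key (x - 1 - i) i h (by omega))
    · exact Or.inr H.hole
  · intro i j₁ j₂ h1 h2 h3
    exact H.row i j₁ j₂ h1 h2 (by omega) (by omega) (by omega)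
  · intro i j₁ j₂ h1 h2 h3
    exact H.col i j₁ j₂ h1 h2 (by omega) (by omega) (by omega)
  · intro i j h1 h2
    have := H.holes i j h1 h2
    omega
  · intro i hi
    exact H.tail i _ hi (by omega) (by omega)
  · intro j₁ j₂ h1 h2 h3
    exact H.mono j₁ j₂ h1 h2 (by omega)
  · intro j h1 h2
    have := H.below j h1 (by omega)
    omega
  · intro j h1 h2
    exact H.sep j h1 (by omega)

/-- The lowest hole at rest starts to slide back. -/
theorem Settled.start_back (H : Settled k (r + 1) I Z a) (hz : Z r k)
    (ha : a r k = k) : ∃ c p, Sliding k r I c p Z a r k := by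
  obtain ⟨c, p, hkc, hc, hmono, hp, hsep⟩ := H.separated
  have hle := H.le_row
  refine ⟨c, p, H.le, H.off, H.lower, ?_, ?_, ?_, hz, ha, le_rfl, by omega, ?_, H.single, ?_, ?_,
    ?_, ?_, ?_⟩
  · intro i hi
    exact H.final i (by omega)
  · intro i j₁ j₂ h1 h2 h3 _ _
    exact H.row i j₁ j₂ h1 h2 (by omega)
  · intro i j₁ j₂ h1 h2 h3 _ _
    exact H.col i j₁ j₂ h1 h2 (by omega)
  · intro i j h1 h2
    have := H.holes i j h1 h2
    omega
  · intro i j hi hj hk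
    rcases hj.eq_or_lt with rfl | h
    · exact hc i hi
    · have := H.row i c j hkc h (by omega)
      have := hc i hi
      have := H.le i j
      omega
  · intro j₁ j₂ h1 h2 h3
    exact hmono j₁ j₂ h1 h2 (by omega)
  · intro j h1 h2
    omega
  · intro j h1 h2
    have := hp j h1 h2
    omega
  · intro j h1 h2
    exact hsep j h1 (by omega)

/-- A hole that can move neither south nor east has arrived at its original cell. -/
theorem Sliding.settled_of_back (hZ : IsSlideShape k Z) (H : Sliding k r I c p Z a x y)
    (hS : a (x + 1) y = k) (hE : a x (y + 1) = k) : Settled k r x Z a := by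
  have hky := hZ.le_col _ _ H.mem
  have hr := H.le_row
  have hI := H.row_lt
  refine ⟨H.le, H.off, H.lower, H.final, ?_, ?_, hr, ?_, ?_, y, p, hky, ?_, ?_,
    H.upper, ?_⟩
  · intro i j₁ j₂ h1 h2 h3
    by_cases e : i = x ∧ j₁ = y
    · obtain ⟨rfl, rfl⟩ := e
      by_cases e2 : j₂ = j₁ + 1
      · rw [e2, hE]; exact H.le _ _
      · have := H.row i (j₁ + 1) j₂ (by omega) (by omega) (by omega) (by omega) (by omega)
        have := H.hole
        omega
    by_cases e' : i = x ∧ j₂ = y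
    · rw [e'.1, e'.2, H.hole]; exact H.le _ _
    exact H.row i j₁ j₂ h1 h2 h3 e e'
  · intro i₁ i₂ j h1 h2 h3
    by_cases e : i₁ = x ∧ j = y
    · obtain ⟨rfl, rfl⟩ := e
      by_cases e2 : i₂ = i₁ + 1
      · rw [e2, hS]; exact Or.inr rfl
      · have := H.col (i₁ + 1) i₂ j (by omega) (by omega) (by omega) (by omega) (by omega)
        have := H.le i₂ j
        omega
    by_cases e' : i₂ = x ∧ j = y
    · rw [e'.1, e'.2, H.hole]; exact Or.inr rfl
    exact H.col i₁ i₂ j h1 h2 h3 e e'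
  · intro i j h1 h2
    have := H.holes i j h1 h2
    omega
  · intro i j₁ j₂ hi z₁ z₂ a₁ a₂
    rcases lt_or_ge i I with h | h
    · have := H.holes i j₁ z₁ a₁
      have := H.holes i j₂ z₂ a₂
      omega
    · exact H.single i j₁ j₂ h z₁ z₂ a₁ a₂
  · intro i hi
    rcases hi.eq_or_lt with rfl | h
    · exact H.hole
    by_cases e : i = x + 1
    · rw [e]; exact hS
    · have := H.col (x + 1) i y hky (by omega) (by omega) (by omega) (by omega)
      have := H.le i y
      omega
  · intro j₁ j₂ h1 h2 h3
    exact H.mono j₁ j₂ h1 h2 (by omega)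
  · intro j h1 h2
    exact H.sep j h1 (by omega)

theorem Settled.skip (H : Settled k r I Z a) (h : ∀ j, Z I j → a I j ≠ k) :
    Settled k r (I + 1) Z a := by
  obtain ⟨c, p, hkc, hc, hmono, hp, hsep⟩ := H.separated
  have hle := H.le_row
  refine ⟨H.le, H.off, H.lower, H.final, H.row, H.col, by omega, ?_, ?_, c, p, hkc, ?_, hmono, ?_,
    hsep⟩
  · intro i j h1 h2
    have := H.holes i j h1 h2
    rcases eq_or_ne i I with rfl | hi
    · exact absurd h2 (h j h1)
    · omega
  · intro i j₁ j₂ hi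
    exact H.single i j₁ j₂ (by omega)
  · intro i hi
    exact hc i (by omega)
  · intro j h1 h2
    have := hp j h1 h2
    omega

theorem Settled.skip_back (hZ : IsSlideShape k Z) (H : Settled k (r + 1) I Z a) (hk : r ≤ k)
    (h : a r k = r)
    (hz : ¬ (Z r k ∧ a r k = k)) : Settled k r I Z a := by
  obtain ⟨c, p, hkc, hc, hmono, hp, hsep⟩ := H.separated
  have hle := H.le_row
  refine ⟨H.le, H.off, H.lower, ?_, ?_, ?_, by omega, ?_, H.single, c, p, hkc, hc, hmono, ?_, hsep⟩
  · intro i hi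
    exact H.final i (by omega)
  · intro i j₁ j₂ h1 h2 h3
    by_cases e : j₁ = k ∧ i = r
    · rw [e.1, e.2, h]; exact H.lower r j₂ (by omega) hk
    · exact H.row i j₁ j₂ h1 h2 (by omega)
  · intro i₁ i₂ j h1 h2 h3
    by_cases e : j = k ∧ i₁ = r
    · obtain ⟨rfl, rfl⟩ := e
      have h4 := H.le i₂ j
      rcases le_or_gt i₂ j with h5 | h5
      · have := H.lower i₂ j le_rfl h5
        omega
      · exact Or.inr (H.off _ _ h1 fun h6 => by have := hZ.row_le _ _ h6; omega)
    · exact H.col i₁ i₂ j h1 h2 (by omega)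
  · intro i j h1 h2
    have := H.holes i j h1 h2
    by_cases e : j = k ∧ i = r
    · rw [e.1, e.2] at h1 h2; exact absurd ⟨h1, h2⟩ hz
    · omega
  · intro j h1 h2
    have := hp j h1 h2
    omega

/-- When the first `I` rows contain no hole at all, every row may be regarded as unprocessed. -/
theorem Settled.restart (hZ : IsSlideShape k Z) (H : Settled k 0 I Z a) : Settled k 0 0 Z a := by
  obtain ⟨B, hB⟩ := hZ.bdd
  refine ⟨H.le, H.off, H.lower, H.final, H.row, H.col, le_rfl, fun _ _ _ _ => Or.inr (by omega),
    ?_, max B k, fun _ => 0, by omega, ?_, fun _ _ _ _ _ => le_rfl, fun _ _ _ => ⟨le_rfl, le_rfl⟩,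
    fun _ _ _ => Or.inl rfl⟩
  · intro i j₁ j₂ _ z₁ z₂ a₁ a₂
    rcases lt_or_ge i I with h | h
    · have := H.holes i j₁ z₁ a₁
      omega
    · exact H.single i j₁ j₂ h z₁ z₂ a₁ a₂
  · intro i _
    refine H.off _ _ (by omega) fun h => ?_
    have := hB _ _ h
    omega

/-- Once no hole is pending, the unprimed letters in column `k` are forced: strict increase puts
each letter `i` in row `i`. -/
theorem Settled.final_of_le (hZ : IsSlideShape k Z) (H : Settled k r I Z a) (hI : k < I) :
    ∀ i, i ≤ k → a i k = i ∨ a i k = k := by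
  have hle := H.le_row
  have key : ∀ d i, r ≤ i → i + d = k → a i k = i := by
    intro d
    induction d with
    | zero =>
      intro i h1 h2
      have := H.lower i k le_rfl (by omega)
      have := H.le i k
      omega
    | succ d ih =>
      intro i h1 h2
      have h3 := ih (i + 1) (by omega) (by omega)
      have := H.col i (i + 1) k le_rfl (by omega) (by omega)
      have := H.lower i k le_rfl (by omega)
      have h5 := H.holes i k (hZ.full i (by omega))
      have := H.le i k
      omega
  intro i hi
  rcases lt_or_ge i r with h | h
  · exact H.final i h
  · exact Or.inl (key (k - i) i h (by omega))

end

/-! ### Moves in a filling -/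

section

/-- The small letters of a filling: the unprimed letter in cell `(i, j)` if it is less than `k`, and
`k` if the cell is empty or contains any other letter. -/
def val (k : ℕ) (F : Filling) (i j : ℕ) : ℕ :=
  match F (i, j) with
  | some (.unprimed b) => min b k
  | _ => k

theorem val_le (k : ℕ) (F : Filling) (i j : ℕ) : val k F i j ≤ k := by
  unfold val; split <;> simp

theorem val_unprimed {k : ℕ} {F : Filling} {i j b : ℕ} (h : F (i, j) = some (.unprimed b)) :
    val k F i j = min b k := by simp [val, h]

theorem val_primed {k : ℕ} {F : Filling} {i j b : ℕ} (h : F (i, j) = some (.primed b)) :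
    val k F i j = k := by simp [val, h]

/-- The region `Z` contains only letters `k'` and unprimed letters less than `k`, and it contains
all letters `k'`. -/
structure OnShape (k : ℕ) (Z : ℕ → ℕ → Prop) (F : Filling) : Prop where
  cells : ∀ i j, Z i j → F (i, j) = some (.primed k) ∨ ∃ b < k, F (i, j) = some (.unprimed b)
  primed : ∀ i j, F (i, j) = some (.primed k) → Z i j

theorem OnShape.eq_unprimed {k : ℕ} {Z : ℕ → ℕ → Prop} {F : Filling} (H : OnShape k Z F)
    {i j : ℕ} (hz : Z i j) (h : val k F i j < k) : F (i, j) = some (.unprimed (val k F i j)) := by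
  rcases H.cells i j hz with e | ⟨b, hb, e⟩
  · rw [val_primed e] at h; omega
  · rw [val_unprimed e, min_eq_left hb.le, e]

theorem OnShape.eq_primed {k : ℕ} {Z : ℕ → ℕ → Prop} {F : Filling} (H : OnShape k Z F)
    {i j : ℕ} (hz : Z i j) (h : val k F i j = k) : F (i, j) = some (.primed k) := by
  rcases H.cells i j hz with e | ⟨b, hb, e⟩
  · exact e
  · rw [val_unprimed e] at h; omega

theorem swap_filling_left (F : Filling) (c d : ℕ × ℕ) : (F ∘ Equiv.swap c d) c = F d := by simp

theorem swap_filling_right (F : Filling) (c d : ℕ × ℕ) : (F ∘ Equiv.swap c d) d = F c := by simp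

theorem swap_filling_of_ne (F : Filling) (c d e : ℕ × ℕ) (h : e ≠ c) (h' : e ≠ d) :
    (F ∘ Equiv.swap c d) e = F e := by simp [Equiv.swap_apply_of_ne_of_ne h h']

theorem swap_filling_swap (F : Filling) (c d : ℕ × ℕ) :
    (F ∘ Equiv.swap c d) ∘ Equiv.swap d c = F := by
  funext e; simp [Equiv.swap_comm d c]

theorem val_congr {k : ℕ} {F G : Filling} {i j i' j' : ℕ} (h : F (i, j) = G (i', j')) :
    val k F i j = val k G i' j' := by simp [val, h]

theorem OnShape.swap {k : ℕ} {Z : ℕ → ℕ → Prop} {F : Filling} (H : OnShape k Z F)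
    {x y x' y' : ℕ} (hz : Z x y) (hz' : Z x' y') :
    OnShape k Z (F ∘ Equiv.swap (x, y) (x', y')) := by
  constructor
  · intro i j h
    by_cases e : (i, j) = (x, y)
    · rw [e, swap_filling_left]; exact H.cells _ _ hz'
    by_cases e' : (i, j) = (x', y')
    · rw [e', swap_filling_right]; exact H.cells _ _ hz
    rw [swap_filling_of_ne _ _ _ _ e e']; exact H.cells i j h
  · intro i j h
    by_cases e : (i, j) = (x, y)
    · simp only [Prod.mk.injEq] at e; rw [e.1, e.2]; exact hz
    by_cases e' : (i, j) = (x', y')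
    · simp only [Prod.mk.injEq] at e'; rw [e'.1, e'.2]; exact hz'
    rw [swap_filling_of_ne _ _ _ _ e e'] at h; exact H.primed i j h

/-- The cell to which a letter `k'` moves when it slides back, or `none` if it stays: it moves to
the southern or the eastern neighbour, whichever contains the lesser letter, and south in case of
equality. Only unprimed letters less than `k` are interchanged with `k'`. -/
def prevCell (k : ℕ) (F : Filling) (c : ℕ × ℕ) : Option (ℕ × ℕ) :=
  if val k F (c.1 + 1) c.2 = k ∧ val k F c.1 (c.2 + 1) = k then none
  else if val k F (c.1 + 1) c.2 ≤ val k F c.1 (c.2 + 1) then some (c.1 + 1, c.2)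
  else some (c.1, c.2 + 1)

/-- One backward move of the letter `k'` in the current cell. -/
def moveBack (k : ℕ) (s : Filling × (ℕ × ℕ)) : Filling × (ℕ × ℕ) :=
  match prevCell k s.1 s.2 with
  | some c => (s.1 ∘ Equiv.swap s.2 c, c)
  | none => s

/-- A filling and the cell of a letter `k'` in the middle of its slide, as in `Sliding`. -/
def IsSliding (k r I : ℕ) (Z : ℕ → ℕ → Prop) (s : Filling × (ℕ × ℕ)) : Prop :=
  OnShape k Z s.1 ∧ ∃ c p, Sliding k r I c p Z (val k s.1) s.2.1 s.2.2

variable {k r I : ℕ} {Z : ℕ → ℕ → Prop}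

section
variable {F : Filling} {x y x' y' : ℕ}

theorem val_swap_left : val k (F ∘ Equiv.swap (x, y) (x', y')) x y = val k F x' y' :=
  val_congr (swap_filling_left _ _ _)

theorem val_swap_right : val k (F ∘ Equiv.swap (x, y) (x', y')) x' y' = val k F x y :=
  val_congr (swap_filling_right _ _ _)

theorem val_swap_of_ne (i j : ℕ) (h : ¬ (i = x ∧ j = y)) (h' : ¬ (i = x' ∧ j = y')) :
    val k (F ∘ Equiv.swap (x, y) (x', y')) i j = val k F i j :=
  val_congr (swap_filling_of_ne _ _ _ _ (by simpa using h) (by simpa using h'))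

theorem move_of_nextCell {c d : ℕ × ℕ} (h : nextCell k F c = some d) :
    move k (F, c) = (F ∘ Equiv.swap c d, d) := by simp [move, h]

theorem moveBack_of_prevCell {c d : ℕ × ℕ} (h : prevCell k F c = some d) :
    moveBack k (F, c) = (F ∘ Equiv.swap c d, d) := by simp [moveBack, h]

theorem prevCell_south (h : val k F (x + 1) y < k) (h' : val k F (x + 1) y ≤ val k F x (y + 1)) :
    prevCell k F (x, y) = some (x + 1, y) := by
  unfold prevCell
  rw [if_neg (by simp only; omega), if_pos h']

theorem prevCell_east (h' : val k F x (y + 1) < val k F (x + 1) y) :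
    prevCell k F (x, y) = some (x, y + 1) := by
  have := val_le k F (x + 1) y
  unfold prevCell
  rw [if_neg (by simp only; omega), if_neg (by simp only; omega)]

end

/-- A sliding letter `k'` either stays, in column `k`, or makes a move which leads to a sliding
state again and is undone by the backward move. -/
theorem IsSliding.move_or_halt (hZ : IsSlideShape k Z) {F : Filling} {x y : ℕ}
    (H : IsSliding k r I Z (F, (x, y))) :
    (nextCell k F (x, y) = none ∧ y = k ∧ (r < x → val k F (x - 1) k < x)) ∨
    ∃ x' y', nextCell k F (x, y) = some (x', y') ∧ Z x' y' ∧ x' + y' + 1 = x + y ∧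
      IsSliding k r I Z (F ∘ Equiv.swap (x, y) (x', y'), (x', y')) ∧
      moveBack k (F ∘ Equiv.swap (x, y) (x', y'), (x', y')) = (F, (x, y)) := by
  obtain ⟨hF, c, p, H⟩ := H
  simp only at hF H
  have hky := hZ.le_col _ _ H.mem
  have hr := H.le_row
  have hlt := H.row_lt
  rcases hky.eq_or_lt with rfl | hky
  · -- the hole is in column `k`
    cases x with
    | zero => left; exact ⟨by simp [nextCell], rfl, by omega⟩
    | succ x =>
      have hN : Z x k := hZ.closed _ _ _ _ H.mem (by omega) le_rfl le_rfl
      rcases lt_or_ge x r with hxr | hxr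
      · left
        refine ⟨?_, rfl, by omega⟩
        rcases hF.cells x k hN with e | ⟨b, hb, e⟩
        · simp [nextCell, e]
        · have := H.final x hxr
          rw [val_unprimed e] at this
          simp only [nextCell, e]
          rw [if_neg (by omega), if_neg (by omega)]
      · have hNlt := H.lt_of_mem hN (by omega) (by omega) (by omega)
        have e := hF.eq_unprimed hN hNlt
        by_cases hb : x + 1 ≤ val k F x k
        · right
          have h2 := val_swap_right (k := k) (F := F) (x := x + 1) (y := k) (x' := x) (y' := k)
          have h1 := val_swap_left (k := k) (F := F) (x := x + 1) (y := k) (x' := x) (y' := k)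
          rw [H.hole] at h2
          have := H.north hZ h1 h2 val_swap_of_ne (fun _ => hxr) (by omega) (fun _ => hb)
          refine ⟨x, k, ?_, hN, by omega, ⟨hF.swap H.mem hN, c, p, this.1⟩, ?_⟩
          · simp only [nextCell, e]
            rw [if_neg (by omega), if_pos hb]
          · rw [moveBack_of_prevCell (prevCell_south (by rw [h1]; exact hNlt) this.2),
              swap_filling_swap]
        · left
          refine ⟨?_, rfl, by intro _; simpa using hb⟩
          simp only [nextCell, e]
          rw [if_neg (by omega), if_neg hb]
  · -- the hole is to the right of column `k`
    right
    obtain ⟨y, rfl⟩ : ∃ z, y = z + 1 := ⟨y - 1, by omega⟩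
    have hky' : k ≤ y := by omega
    have hp := H.upper y hky' (by omega)
    have hW : Z x y := hZ.closed _ _ _ _ H.mem le_rfl hky' (by omega)
    have hWlt := H.lt_of_mem hW (by omega) (by omega) (by omega)
    have eW := hF.eq_unprimed hW hWlt
    have west : (x = 0 ∨ val k F (x - 1) (y + 1) < val k F x y) →
        nextCell k F (x, y + 1) = some (x, y) →
      ∃ x' y', nextCell k F (x, y + 1) = some (x', y') ∧ Z x' y' ∧ x' + y' + 1 = x + (y + 1) ∧
      IsSliding k r I Z (F ∘ Equiv.swap (x, y + 1) (x', y'), (x', y')) ∧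
      moveBack k (F ∘ Equiv.swap (x, y + 1) (x', y'), (x', y')) = (F, (x, y + 1)) := by
      intro hlt hn
      have h2 := val_swap_right (k := k) (F := F) (x := x) (y := y + 1) (x' := x) (y' := y)
      have h1 := val_swap_left (k := k) (F := F) (x := x) (y := y + 1) (x' := x) (y' := y)
      rw [H.hole] at h2
      have := H.west hZ hky' h1 h2 val_swap_of_ne hlt
      refine ⟨x, y, hn, hW, by omega, ⟨hF.swap H.mem hW, c, _, this.1⟩, ?_⟩
      rw [moveBack_of_prevCell (prevCell_east this.2), swap_filling_swap]
    cases x with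
    | zero =>
      apply west (Or.inl rfl)
      simp [nextCell, eW, hky]
    | succ x =>
      have hN : Z x (y + 1) := hZ.closed _ _ _ _ H.mem (by omega) (by omega) le_rfl
      have hNlt := H.lt_of_mem hN (by omega) (by omega) (by omega)
      have eN := hF.eq_unprimed hN hNlt
      by_cases hb : val k F (x + 1) y ≤ val k F x (y + 1)
      · have h2 := val_swap_right (k := k) (F := F) (x := x + 1) (y := y + 1) (x' := x)
          (y' := y + 1)
        have h1 := val_swap_left (k := k) (F := F) (x := x + 1) (y := y + 1) (x' := x)
          (y' := y + 1)
        rw [H.hole] at h2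
        have := H.north hZ h1 h2 val_swap_of_ne (by omega) (fun _ => by simpa using hb) (by omega)
        refine ⟨x, y + 1, ?_, hN, by omega, ⟨hF.swap H.mem hN, c, p, this.1⟩, ?_⟩
        · simp [nextCell, eW, eN, hky, hb]
        · rw [moveBack_of_prevCell (prevCell_south (by rw [h1]; exact hNlt) this.2),
              swap_filling_swap]
      · apply west (Or.inr (by simpa using hb))
        simp [nextCell, eW, eN, hky, hb]

/-- A letter `k'` sliding back either stays, or makes a backward move which leads to a sliding state
again and is undone by the forward move. -/
theorem IsSliding.moveBack_or_halt (hZ : IsSlideShape k Z) {F : Filling} {x y : ℕ}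
    (H : IsSliding k r I Z (F, (x, y))) :
    prevCell k F (x, y) = none ∨
    ∃ x' y', prevCell k F (x, y) = some (x', y') ∧ Z x' y' ∧ x' + y' = x + y + 1 ∧
      IsSliding k r I Z (F ∘ Equiv.swap (x, y) (x', y'), (x', y')) ∧
      move k (F ∘ Equiv.swap (x, y) (x', y'), (x', y')) = (F, (x, y)) := by
  obtain ⟨hF, c, p, H⟩ := H
  simp only at hF H
  have hky := hZ.le_col _ _ H.mem
  have hr := H.le_row
  have hlt := H.row_lt
  have hle := val_le k F (x + 1) y
  have hle' := val_le k F x (y + 1)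
  by_cases h0 : val k F (x + 1) y = k ∧ val k F x (y + 1) = k
  · left; simp [prevCell, h0]
  right
  rcases le_or_gt (val k F (x + 1) y) (val k F x (y + 1)) with h | h
  · have hSlt : val k F (x + 1) y < k := by omega
    have hS : Z (x + 1) y := by
      by_contra hz; have := H.off _ _ hky hz; omega
    have h2 := val_swap_right (k := k) (F := F) (x := x) (y := y) (x' := x + 1) (y' := y)
    have h1 := val_swap_left (k := k) (F := F) (x := x) (y := y) (x' := x + 1) (y' := y)
    rw [H.hole] at h2
    obtain ⟨H', hW, hb⟩ := H.south hZ h1 h2 val_swap_of_ne hSlt h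
    have hF' := hF.swap H.mem hS
    refine ⟨x + 1, y, prevCell_south hSlt h, hS, by omega, ⟨hF', c, p, H'⟩, ?_⟩
    have eN := hF'.eq_unprimed H.mem (by rw [h1]; exact hSlt)
    rw [move_of_nextCell (d := (x, y)), swap_filling_swap]
    rcases hky.eq_or_lt with rfl | hky
    · simp only [nextCell, eN]
      rw [if_neg (by omega), if_pos hb]
    · obtain ⟨y, rfl⟩ : ∃ z, y = z + 1 := ⟨y - 1, by omega⟩
      have hp := H'.upper y (by omega) (by omega)
      have hWZ : Z (x + 1) y := hZ.closed _ _ _ _ hS le_rfl (by omega) (by omega)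
      have hlt' := H'.row_lt
      have eW := hF'.eq_unprimed hWZ
        (H'.lt_of_mem hWZ (by omega) (by have := H.le_row; omega) (by omega))
      have := hW hky
      rw [Nat.add_sub_cancel] at this
      simp only [nextCell, eN, Nat.add_sub_cancel, eW]
      rw [if_pos hky, if_pos this]
  · have hElt : val k F x (y + 1) < k := by omega
    have hE : Z x (y + 1) := by
      by_contra hz; have := H.off x (y + 1) (by omega) hz; omega
    have h2 := val_swap_right (k := k) (F := F) (x := x) (y := y) (x' := x) (y' := y + 1)
    have h1 := val_swap_left (k := k) (F := F) (x := x) (y := y) (x' := x) (y' := y + 1)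
    rw [H.hole] at h2
    obtain ⟨H', hN⟩ := H.east hZ h1 h2 val_swap_of_ne hElt h
    have hF' := hF.swap H.mem hE
    refine ⟨x, y + 1, prevCell_east h, hE, by omega, ⟨hF', c, _, H'⟩, ?_⟩
    have eW := hF'.eq_unprimed H.mem (by rw [h1]; exact hElt)
    have hlt' := H'.row_lt
    rw [move_of_nextCell (d := (x, y)), swap_filling_swap]
    cases x with
    | zero =>
      simp only [nextCell, Nat.add_sub_cancel, eW]
      rw [if_pos (by omega)]
    | succ x =>
      have hNZ : Z x (y + 1) := hZ.closed _ _ _ _ hE (by omega) (by omega) le_rfl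
      have eN := hF'.eq_unprimed hNZ (H'.lt_of_mem hNZ (by omega) (by omega) (by omega))
      simp only [nextCell, eN, Nat.add_sub_cancel, eW]
      rw [if_pos (by omega), if_neg (by simp at hN; omega)]

end

/-! ### Sliding all letters of one kind -/

section

/-- A filling between two slides, as in `Settled`. -/
def IsSettled (k r I : ℕ) (Z : ℕ → ℕ → Prop) (F : Filling) : Prop :=
  OnShape k Z F ∧ Settled k r I Z (val k F)

/-- Two fillings agree outside the region `Z`. -/
def AgreeOff (Z : ℕ → ℕ → Prop) (F G : Filling) : Prop := ∀ i j, ¬ Z i j → F (i, j) = G (i, j)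

variable {k r I n : ℕ} {Z : ℕ → ℕ → Prop} {F G : Filling} {x y : ℕ}

theorem AgreeOff.refl (Z : ℕ → ℕ → Prop) (F : Filling) : AgreeOff Z F F := fun _ _ _ => rfl

theorem AgreeOff.trans {E : Filling} (h : AgreeOff Z E F) (h' : AgreeOff Z F G) :
    AgreeOff Z E G := fun i j hz => (h i j hz).trans (h' i j hz)

theorem AgreeOff.swap {x' y' : ℕ} (hz : Z x y) (hz' : Z x' y') :
    AgreeOff Z (F ∘ Equiv.swap (x, y) (x', y')) F := by
  intro i j h
  apply swap_filling_of_ne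
  · rintro ⟨⟩; exact h hz
  · rintro ⟨⟩; exact h hz'

theorem IsSliding.mem (H : IsSliding k r I Z (F, (x, y))) : Z x y := by
  obtain ⟨_, _, _, H⟩ := H; exact H.mem

/-- Any number `m ≥ x + y` of moves brings a sliding letter `k'` to rest in column `k`, and backward
moves bring it back. -/
theorem IsSliding.exists_landing (hZ : IsSlideShape k Z) :
    ∀ (m : ℕ) (F : Filling) (x y : ℕ), IsSliding k r I Z (F, (x, y)) → x + y ≤ m →
    ∃ F' x', (move k)^[m] (F, (x, y)) = (F', (x', k)) ∧ IsSettled k (x' + 1) I Z F' ∧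
      F' (x', k) = some (.primed k) ∧ r ≤ x' ∧ AgreeOff Z F' F ∧
      ∃ d, (moveBack k)^[d] (F', (x', k)) = (F, (x, y)) := by
  have halt : ∀ (m : ℕ) (F : Filling) (x y : ℕ), IsSliding k r I Z (F, (x, y)) →
      (nextCell k F (x, y) = none ∧ y = k ∧ (r < x → val k F (x - 1) k < x)) →
    ∃ F' x', (move k)^[m] (F, (x, y)) = (F', (x', k)) ∧ IsSettled k (x' + 1) I Z F' ∧
      F' (x', k) = some (.primed k) ∧ r ≤ x' ∧ AgreeOff Z F' F ∧
      ∃ d, (moveBack k)^[d] (F', (x', k)) = (F, (x, y)) := by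
    rintro m F x y ⟨hF, c, p, H⟩ ⟨h1, rfl, h2⟩
    have hm : move y (F, (x, y)) = (F, (x, y)) := by simp [move, h1]
    exact ⟨F, x, Function.iterate_fixed hm m, ⟨hF, H.settled_of_forward hZ h2⟩,
      hF.eq_primed H.mem H.hole, H.le_row, AgreeOff.refl _ _, 0, rfl⟩
  intro m
  induction m with
  | zero =>
    intro F x y H hm
    rcases H.move_or_halt hZ with h | ⟨x', y', -, -, h, -⟩
    · exact halt _ _ _ _ H h
    · omega
  | succ m ih =>
    intro F x y H hm
    rcases H.move_or_halt hZ with h | ⟨x', y', h1, h2, h3, h4, h5⟩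
    · exact halt _ _ _ _ H h
    · obtain ⟨F', x'', g1, g2, g3, g4, g5, d, g6⟩ := ih _ _ _ h4 (by omega)
      refine ⟨F', x'', ?_, g2, g3, g4, g5.trans (AgreeOff.swap H.mem h2), d + 1, ?_⟩
      · rw [Function.iterate_succ_apply, move_of_nextCell h1, g1]
      · rw [Function.iterate_succ_apply', g6, h5]

/-- A letter `k'` sliding back arrives at a cell from which the forward slide returns it. The number
`m` bounds the number of backward moves, each of which increases `x + y`. -/
theorem IsSliding.exists_origin (hZ : IsSlideShape k Z) {B : ℕ} (hB : ∀ i j, Z i j → j < B) :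
    ∀ (m : ℕ) (F : Filling) (x y : ℕ), IsSliding k r I Z (F, (x, y)) → k + B ≤ m + (x + y) →
    ∃ F' x' y' d, (move k)^[d] (F', (x', y')) = (F, (x, y)) ∧ d + (x + y) = x' + y' ∧
      IsSettled k r x' Z F' ∧ F' (x', y') = some (.primed k) ∧ x' < I ∧ AgreeOff Z F F' := by
  intro m
  induction m with
  | zero =>
    intro F x y H hm
    have := hB _ _ H.mem
    have := hZ.row_le _ _ H.mem
    omega
  | succ m ih =>
    intro F x y H hm
    rcases H.moveBack_or_halt hZ with h | ⟨x', y', h1, h2, h3, h4, h5⟩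
    · obtain ⟨hF, c, p, H⟩ := H
      have h0 : val k F (x + 1) y = k ∧ val k F x (y + 1) = k := by
        by_contra h0
        rw [prevCell, if_neg h0] at h
        split at h <;> cases h
      exact ⟨F, x, y, 0, rfl, by simp, ⟨hF, H.settled_of_back hZ h0.1 h0.2⟩,
        hF.eq_primed H.mem H.hole, H.row_lt, AgreeOff.refl _ _⟩
    · obtain ⟨F', x'', y'', d, g1, g2, g3, g4, g5, g6⟩ := ih _ _ _ h4 (by omega)
      refine ⟨F', x'', y'', d + 1, ?_, by omega, g3, g4, g5, ?_⟩
      · rw [Function.iterate_succ_apply', g1, h5]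
      · intro i j hz
        rw [← g6 i j hz, AgreeOff.swap H.mem h2 i j hz]

theorem slideRow_of_forall_ne {i : ℕ} (h : ∀ j, F (i, j) ≠ some (.primed k)) :
    slideRow k F i = F := by
  rw [slideRow, dif_neg]
  rintro ⟨j, hj⟩
  exact h j hj

theorem IsSettled.slideRow_eq {i : ℕ} (H : IsSettled k r I Z F) (hi : I ≤ i)
    (h : F (i, y) = some (.primed k)) : slideRow k F i = slide k F (i, y) := by
  have hex : ∃ j, F (i, j) = some (.primed k) := ⟨y, h⟩
  classical
  rw [slideRow, dif_pos hex]
  have h1 := Nat.find_spec hex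
  have h2 := H.2.single i _ _ hi (H.1.primed _ _ h1) (H.1.primed _ _ h) (val_primed h1)
    (val_primed h)
  convert rfl using 3
  convert h2.symm

/-- `SlidesBack k r F G` says that `G` is obtained from `F` by sliding back the letters `k'` in the
rows `r - 1, …, 1, 0` of column `k`, in this order, each until it stays. -/
def SlidesBack (k : ℕ) : ℕ → Filling → Filling → Prop
  | 0, F, G => F = G
  | r + 1, F, G =>
    (F (r, k) ≠ some (.primed k) ∧ SlidesBack k r F G) ∨
    (F (r, k) = some (.primed k) ∧ ∃ d E c, (moveBack k)^[d] (F, (r, k)) = (E, c) ∧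
      prevCell k E c = none ∧ SlidesBack k r E G)

/-- Backward slides are deterministic, which is what makes `theta` injective. -/
theorem SlidesBack.unique {G' : Filling} :
    ∀ (r : ℕ) (F : Filling), SlidesBack k r F G → SlidesBack k r F G' → G = G' := by
  intro r
  induction r with
  | zero => rintro F rfl rfl; rfl
  | succ r ih =>
    rintro F (⟨h1, h2⟩ | ⟨h1, d, E, c, h2, h3, h4⟩) (⟨h1', h2'⟩ | ⟨h1', d', E', c', h2', h3', h4'⟩)
    · exact ih F h2 h2'
    · exact absurd h1' h1
    · exact absurd h1 h1'
    · have fix : moveBack k (E, c) = (E, c) := by simp [moveBack, h3]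
      have fix' : moveBack k (E', c') = (E', c') := by simp [moveBack, h3']
      have e : (E, c) = (E', c') := by
        rw [← Function.iterate_fixed fix d', ← Function.iterate_fixed fix' d, ← h2, ← h2',
          ← Function.iterate_add_apply, ← Function.iterate_add_apply, add_comm]
      obtain ⟨rfl, rfl⟩ := Prod.mk.inj e
      exact ih E h4 h4'

theorem SlidesBack.extend (h : SlidesBack k r F G) {s : ℕ} (hrs : r ≤ s)
    (hF : ∀ i, r ≤ i → i < s → F (i, k) ≠ some (.primed k)) : SlidesBack k s F G := by
  induction s, hrs using Nat.le_induction with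
  | base => exact h
  | succ s hs ih => exact Or.inl ⟨hF s hs (by omega), ih fun i h1 h2 => hF i h1 (by omega)⟩

theorem IsSettled.ne_primed (H : IsSettled k r I Z F) {i j : ℕ} (hi : r ≤ i) (hI : i < I) :
    F (i, j) ≠ some (.primed k) := by
  intro h
  have := H.2.holes i j (H.1.primed _ _ h) (val_primed h)
  omega

/-- Sliding the letter `k'` of row `I` leads to a settled filling again, and sliding it back leads
to the previous one. -/
theorem IsSettled.slideRow (hZ : IsSlideShape k Z) (H : IsSettled k r I Z F) :
    AgreeOff Z (slideRow k F I) F ∧ ∃ r', IsSettled k r' (I + 1) Z (slideRow k F I) ∧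
      ∀ G, SlidesBack k r F G → SlidesBack k r' (slideRow k F I) G := by
  by_cases h : ∃ j, F (I, j) = some (.primed k)
  · obtain ⟨y, hy⟩ := h
    have hz := H.1.primed _ _ hy
    obtain ⟨⟨p, hp⟩, hS, hE⟩ := H.2.start hZ hz (val_primed hy)
    obtain ⟨F', x', h1, h2, h3, h4, h5, d, h6⟩ :=
      IsSliding.exists_landing hZ (I + y) F I y ⟨H.1, y, p, hp⟩ le_rfl
    have e : ShiftedTableaux.slideRow k F I = F' := by
      rw [H.slideRow_eq le_rfl hy, slide, h1]
    have := h2.2.le_row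
    rw [e]
    refine ⟨h5, x' + 1, h2, fun G hG => Or.inr ⟨h3, d, F, (I, y), h6, ?_, ?_⟩⟩
    · rw [prevCell, if_pos ⟨hS, hE⟩]
    · exact hG.extend h4 fun i hi hi' => H.ne_primed hi (by omega)
  · push Not at h
    rw [slideRow_of_forall_ne h]
    exact ⟨AgreeOff.refl _ _, r, ⟨H.1, H.2.skip fun j hz ha => h j (H.1.eq_primed hz ha)⟩,
      fun G hG => hG⟩

theorem IsSettled.foldl (hZ : IsSlideShape k Z) (H : IsSettled k 0 0 Z F) (n : ℕ) :
    AgreeOff Z ((List.range n).foldl (ShiftedTableaux.slideRow k) F) F ∧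
    ∃ r, IsSettled k r n Z ((List.range n).foldl (ShiftedTableaux.slideRow k) F) ∧
      SlidesBack k r ((List.range n).foldl (ShiftedTableaux.slideRow k) F) F := by
  induction n with
  | zero => exact ⟨AgreeOff.refl _ _, 0, H, rfl⟩
  | succ n ih =>
    obtain ⟨h1, r, h2, h3⟩ := ih
    obtain ⟨g1, r', g2, g3⟩ := h2.slideRow hZ
    rw [List.range_succ, List.foldl_append]
    exact ⟨g1.trans h1, r', g2, g3 _ h3⟩

theorem IsSettled.theta (hZ : IsSlideShape k Z) (H : IsSettled k 0 0 Z F) :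
    AgreeOff Z (theta n k F) F ∧ (∃ r, IsSettled k r n Z (theta n k F)) ∧
      SlidesBack k n (theta n k F) F := by
  obtain ⟨h1, r, h2, h3⟩ := H.foldl hZ n
  exact ⟨h1, ⟨r, h2⟩, h3.extend h2.2.le_row fun i hi hn => h2.ne_primed hi hn⟩

theorem IsSettled.nextCell_eq_none (hZ : IsSlideShape k Z) (H : IsSettled k (r + 1) I Z F)
    (hz : Z r k) : nextCell k F (r, k) = none := by
  cases r with
  | zero => simp [nextCell]
  | succ r =>
    rcases H.1.cells r k (hZ.closed _ _ _ _ hz (by omega) le_rfl le_rfl) with e | ⟨b, hb, e⟩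
    · simp [nextCell, e]
    · have := H.2.final r (by omega)
      rw [val_unprimed e] at this
      simp only [nextCell, e]
      rw [if_neg (by omega), if_neg (by omega)]

theorem foldl_slideRow_of_forall_ne {E : Filling} {s : ℕ} (hs : s ≤ I)
    (h : (List.range s).foldl (slideRow k) E = F)
    (hF : ∀ i j, s ≤ i → i < I → F (i, j) ≠ some (.primed k)) :
    (List.range I).foldl (slideRow k) E = F := by
  induction I, hs using Nat.le_induction with
  | base => exact h
  | succ I hI ih =>
    rw [List.range_succ, List.foldl_append, ih fun i j h1 h2 => hF i j h1 (by omega)]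
    exact slideRow_of_forall_ne fun j => hF I j hI (by omega)

/-- Every settled filling arises from forward slides. In the induction on `r`, the letter `k'` in
row `r` of column `k`, if there is one, is slid back to a cell in some row `x < I`; the rows strictly
between `x` and `I` contain no letter `k'`. -/
theorem IsSettled.exists_foldl_eq (hZ : IsSlideShape k Z) :
    ∀ (r I : ℕ) (F : Filling), r ≤ k + 1 → IsSettled k r I Z F → ∃ E, IsSettled k 0 0 Z E ∧
      (List.range I).foldl (ShiftedTableaux.slideRow k) E = F ∧ AgreeOff Z F E := by
  intro r
  induction r with
  | zero =>
    intro I F _ H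
    exact ⟨F, ⟨H.1, H.2.restart hZ⟩, foldl_slideRow_of_forall_ne (s := 0) (by omega) rfl
      fun i j h1 h2 => H.ne_primed h1 h2, AgreeOff.refl _ _⟩
  | succ r ih =>
    intro I F hr H
    by_cases h : F (r, k) = some (.primed k)
    · obtain ⟨B, hB⟩ := hZ.bdd
      obtain ⟨c, p, hp⟩ := H.2.start_back (H.1.primed _ _ h) (val_primed h)
      obtain ⟨F', x, y, d, h1, h2, h3, h4, h5, h6⟩ :=
        IsSliding.exists_origin hZ hB (k + B) F r k ⟨H.1, c, p, hp⟩ (by omega)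
      obtain ⟨E, g1, g2, g3⟩ := ih x F' (by omega) h3
      have hrx := h3.2.le_row
      refine ⟨E, g1, foldl_slideRow_of_forall_ne (s := x + 1) (by omega) ?_ ?_, h6.trans g3⟩
      · rw [List.range_succ, List.foldl_append, g2]
        rw [List.foldl_cons, List.foldl_nil, h3.slideRow_eq le_rfl h4, slide]
        have hm : move k (F, (r, k)) = (F, (r, k)) := by
          simp [move, H.nextCell_eq_none hZ (H.1.primed _ _ h)]
        rw [show x + y = (r + k) + d by omega, Function.iterate_add_apply, h1,
          Function.iterate_fixed hm]
      · exact fun i j h1 h2 => H.ne_primed (by omega) h2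
    · have hz : ¬ (Z r k ∧ val k F r k = k) := fun h' => h (H.1.eq_primed h'.1 h'.2)
      refine ih I F (by omega) ⟨H.1, H.2.skip_back hZ (by omega) ?_ hz⟩
      rcases H.2.final r (by omega) with h' | h'
      · exact h'
      · have : ¬ r < k := fun h2 => hz ⟨hZ.full r h2, h'⟩
        omega

end

/-! ### The stages of the process -/

section

/-- The fillings that occur after the letters `0', …, (k - 1)'` have been slid: the columns before
column `k` satisfy the conditions on triangular tableaux, and the columns from `k` on those on
primed shifted tableaux, with no primed letter less than `k'`. The comparisons are expressed by
ranks: equal letters have odd rank, that is, are unprimed, in a row, and are primed in a column. -/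
structure IsStage (n : ℕ) (mu : ℕ → ℕ) (k : ℕ) (F : Filling) : Prop
    extends IsShiftedFilling n mu F where
  left_unprimed : ∀ i j b, j < k → F (i, j) = some (.unprimed b) → i = b
  left_primed : ∀ i j b, j < k → F (i, j) = some (.primed b) → j = b
  right_primed : ∀ i j b, k ≤ j → F (i, j) = some (.primed b) → k ≤ b
  row : ∀ i j₁ j₂ x y, k ≤ j₁ → j₁ < j₂ → F (i, j₁) = some x → F (i, j₂) = some y →
    x.rank ≤ y.rank ∧ (x.rank = y.rank → x.rank % 2 = 1)
  col : ∀ i₁ i₂ j x y, k ≤ j → i₁ < i₂ → F (i₁, j) = some x → F (i₂, j) = some y →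
    x.rank ≤ y.rank ∧ (x.rank = y.rank → x.rank % 2 = 0)

/-- The shifted diagram of `mu` has rows `0, …, n - 1`, of which row `i` ends in column
`n + l i - 1`, where `l` is weakly decreasing. -/
structure IsWideShape (n : ℕ) (mu l : ℕ → ℕ) : Prop where
  mem : ∀ i j, (i, j) ∈ shiftedDiagram mu ↔ i < n ∧ i ≤ j ∧ j < n + l i
  anti : Antitone l

variable {n k r I : ℕ} {mu l : ℕ → ℕ} {F G : Filling} {Z : ℕ → ℕ → Prop}

theorem Letter.rank_div_two (x : Letter) : x.rank / 2 = x.index := by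
  cases x <;> simp only [Letter.rank, Letter.index] <;> omega

theorem IsStage.cell (hmu : IsWideShape n mu l) (H : IsStage n mu k F) {i j : ℕ} {x : Letter}
    (h : F (i, j) = some x) : i < n ∧ i ≤ j ∧ j < n + l i :=
  (hmu.mem i j).1 ((H.shape _).1 (by rw [h]; rfl))

theorem IsStage.exists_letter (hmu : IsWideShape n mu l) (H : IsStage n mu k F) {i j : ℕ}
    (h₁ : i < n) (h₂ : i ≤ j) (h₃ : j < n + l i) : ∃ x, F (i, j) = some x :=
  Option.isSome_iff_exists.1 ((H.shape _).2 ((hmu.mem i j).2 ⟨h₁, h₂, h₃⟩))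

theorem IsStage.exists_letter_of_le (hmu : IsWideShape n mu l) (H : IsStage n mu k F)
    {i j i' j' : ℕ} {x : Letter} (h : F (i, j) = some x) (hi : i' ≤ i) (hj : j' ≤ j)
    (hij : i' ≤ j') : ∃ x, F (i', j') = some x := by
  have := H.cell hmu h
  have := hmu.anti hi
  exact H.exists_letter hmu (by omega) hij (by omega)

theorem IsStage.row_le_index (hmu : IsWideShape n mu l) (H : IsStage n mu k F) :
    ∀ (i j : ℕ) (x : Letter), k ≤ j → F (i, j) = some x → i ≤ x.index := by
  intro i
  induction i with
  | zero => intros; omega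
  | succ i ih =>
    intro j x hj hx
    have hc := H.cell hmu hx
    obtain ⟨y, hy⟩ := H.exists_letter_of_le hmu hx (i' := i) (j' := j) (by omega) le_rfl (by omega)
    have hyx := H.col _ _ _ _ _ hj (Nat.lt_succ_self i) hy hx
    have := ih j y hj hy
    rcases lt_or_ge i k with hik | hik
    · rcases x with b | b
      · have := H.right_primed _ _ _ hj hx
        simp only [Letter.index]; omega
      · rcases y with b' | b'
        · have := H.right_primed _ _ _ hj hy
          simp only [Letter.index, Letter.rank] at *; omega
        · simp only [Letter.index, Letter.rank] at *; omega
    · -- the index increases strictly along diagonals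
      obtain ⟨z, hz⟩ := H.exists_letter_of_le hmu hx (i' := i) (j' := j - 1) (by omega) (by omega)
        (by omega)
      have hzy := H.row i (j - 1) j z y (by omega) (by omega) hz hy
      have h1 := ih (j - 1) z (by omega) hz
      rw [← Letter.rank_div_two] at *
      omega

/-- The diagonal letters have indices less than `n` that increase strictly down the diagonal, and
the `i`-th index is at least `i`; so it is `i`. -/
theorem IsStage.diag_index (hmu : IsWideShape n mu l) (H : IsStage n mu k F) {i : ℕ} {x : Letter}
    (hi : k ≤ i) (hx : F (i, i) = some x) : x.index = i := by
  have hlow := H.row_le_index hmu i i x hi hx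
  have key : ∀ d i x, k ≤ i → F (i, i) = some x → i + d + 1 = n → x.index ≤ i := by
    intro d
    induction d with
    | zero =>
      intro i x _ hx _
      have := H.bound _ _ hx
      omega
    | succ d ih =>
      intro i x hi hx hd
      obtain ⟨y, hy⟩ := H.exists_letter hmu (i := i) (j := i + 1) (by omega) (by omega) (by omega)
      obtain ⟨z, hz⟩ := H.exists_letter hmu (i := i + 1) (j := i + 1) (by omega) le_rfl (by omega)
      have h1 := H.row _ _ _ _ _ hi (Nat.lt_succ_self i) hx hy
      have h2 := H.col _ _ _ _ _ (by omega) (Nat.lt_succ_self i) hy hz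
      have h3 := ih (i + 1) z (by omega) hz (by omega)
      rw [← Letter.rank_div_two] at *
      omega
  have := H.cell hmu hx
  exact le_antisymm (key (n - 1 - i) i x hi hx (by omega)) hlow

/-- The cells from column `k` on whose letter is at most `k'`. -/
def slideRegion (k : ℕ) (F : Filling) (i j : ℕ) : Prop :=
  k ≤ j ∧ ∃ x, F (i, j) = some x ∧ x.rank ≤ 2 * k

theorem val_lt_iff {i j : ℕ} : val k F i j < k ↔ ∃ b < k, F (i, j) = some (.unprimed b) := by
  constructor
  · intro h
    unfold val at h
    split at h
    · rename_i b hb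
      exact ⟨b, by omega, hb⟩
    · omega
  · rintro ⟨b, hb, h⟩
    rw [val_unprimed h]; omega

theorem val_eq_of_not_slideRegion {i j : ℕ} (hj : k ≤ j) (h : ¬ slideRegion k F i j) :
    val k F i j = k := by
  by_contra h'
  obtain ⟨b, hb, e⟩ := val_lt_iff.1 (lt_of_le_of_ne (val_le k F i j) h')
  exact h ⟨hj, _, e, by simp only [Letter.rank]; omega⟩

theorem lt_rank_of_not_slideRegion {i j : ℕ} {x : Letter} (hj : k ≤ j)
    (h : ¬ slideRegion k F i j) (hx : F (i, j) = some x) : 2 * k < x.rank := by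
  by_contra h'
  exact h ⟨hj, x, hx, by omega⟩

theorem IsStage.isSlideShape (hmu : IsWideShape n mu l) (H : IsStage n mu k F) (hk : k < n) :
    IsSlideShape k (slideRegion k F) := by
  have hrow : ∀ i j, slideRegion k F i j → i ≤ k := by
    rintro i j ⟨hj, x, hx, hr⟩
    have := H.row_le_index hmu i j x hj hx
    rw [← Letter.rank_div_two] at this
    omega
  refine ⟨?_, fun i j h => h.1, hrow, ?_, n + l 0, ?_⟩
  · rintro i j i' j' h hi hj hj'
    have hik := hrow i j h
    obtain ⟨-, x, hx, hr⟩ := h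
    obtain ⟨y, hy⟩ := H.exists_letter_of_le hmu hx hi le_rfl (by omega)
    obtain ⟨z, hz⟩ := H.exists_letter_of_le hmu hx hi hj' (by omega)
    refine ⟨hj, z, hz, ?_⟩
    have h1 : z.rank ≤ y.rank := by
      rcases hj'.eq_or_lt with rfl | h
      · rw [hy] at hz; cases hz; rfl
      · exact (H.row _ _ _ _ _ hj h hz hy).1
    have h2 : y.rank ≤ x.rank := by
      rcases hi.eq_or_lt with rfl | h
      · rw [hy] at hx; cases hx; rfl
      · exact (H.col _ _ _ _ _ (by omega) h hy hx).1
    omega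
  · intro i hi
    obtain ⟨x, hx⟩ := H.exists_letter hmu (i := i) (j := k) (by omega) (by omega) (by omega)
    obtain ⟨y, hy⟩ := H.exists_letter hmu (i := k) (j := k) hk le_rfl (by omega)
    have h1 := H.diag_index hmu le_rfl hy
    have h2 := H.col _ _ _ _ _ le_rfl hi hx hy
    refine ⟨le_rfl, x, hx, ?_⟩
    rw [← Letter.rank_div_two] at h1
    omega
  · rintro i j ⟨-, x, hx, -⟩
    have := H.cell hmu hx
    have := hmu.anti (Nat.zero_le i)
    omega

theorem IsStage.isSettled (hmu : IsWideShape n mu l) (H : IsStage n mu k F) (hk : k < n) :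
    IsSettled k 0 0 (slideRegion k F) F := by
  have hZ := H.isSlideShape hmu hk
  obtain ⟨B, hB⟩ := hZ.bdd
  have hcells : ∀ i j, slideRegion k F i j →
      F (i, j) = some (.primed k) ∨ ∃ b < k, F (i, j) = some (.unprimed b) := by
    rintro i j ⟨hj, x, hx, hr⟩
    rcases x with b | b
    · have := H.right_primed _ _ _ hj hx
      simp only [Letter.rank] at hr
      left; rw [hx, show b = k by omega]
    · simp only [Letter.rank] at hr
      exact Or.inr ⟨b, by omega, hx⟩
  refine ⟨⟨hcells, ?_⟩, val_le k F, fun i j => val_eq_of_not_slideRegion, ?_, by omega, ?_, ?_,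
    le_rfl, fun _ _ _ _ => Or.inr (by omega), ?_, max B k, fun _ => 0, by omega, ?_,
    fun _ _ _ _ _ => le_rfl, fun _ _ _ => ⟨le_rfl, le_rfl⟩, fun _ _ _ => Or.inl rfl⟩
  · intro i j h
    have hj : k ≤ j := by
      by_contra hj
      have := H.left_primed i j k (by omega) h
      omega
    exact ⟨hj, _, h, by simp [Letter.rank]⟩
  · intro i j hj hi
    by_contra h
    obtain ⟨b, hb, e⟩ := val_lt_iff.1 (show val k F i j < k by omega)
    have := H.row_le_index hmu i j _ hj e
    rw [val_unprimed e] at h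
    simp only [Letter.index] at this
    omega
  · intro i j₁ j₂ hj hjj _
    by_contra h
    have := val_le k F i j₁
    obtain ⟨b, hb, e⟩ := val_lt_iff.1 (show val k F i j₂ < k by omega)
    rcases hcells i j₁ (hZ.closed i j₂ i j₁ ⟨by omega, _, e, by simp only [Letter.rank]; omega⟩
      le_rfl hj hjj.le) with e' | ⟨b', hb', e'⟩
    · have := H.row _ _ _ _ _ hj hjj e' e
      simp only [Letter.rank] at this
      omega
    · have := H.row _ _ _ _ _ hj hjj e' e
      simp only [Letter.rank] at this
      rw [val_unprimed e, val_unprimed e'] at h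
      omega
  · intro i₁ i₂ j hj hii _
    by_contra h
    have := val_le k F i₂ j
    obtain ⟨b, hb, e⟩ := val_lt_iff.1 (show val k F i₂ j < k by omega)
    rcases hcells i₁ j (hZ.closed i₂ j i₁ j ⟨by omega, _, e, by simp only [Letter.rank]; omega⟩
      hii.le hj le_rfl) with e' | ⟨b', hb', e'⟩
    · have := H.col _ _ _ _ _ hj hii e' e
      simp only [Letter.rank] at this
      omega
    · have := H.col _ _ _ _ _ hj hii e' e
      simp only [Letter.rank] at this
      rw [val_unprimed e, val_unprimed e'] at h
      omega
  · intro i j₁ j₂ _ z₁ z₂ a₁ a₂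
    have key : ∀ j₁ j₂, slideRegion k F i j₁ → slideRegion k F i j₂ → val k F i j₁ = k →
        val k F i j₂ = k → ¬ j₁ < j₂ := by
      intro j₁ j₂ z₁ z₂ a₁ a₂ h
      have e : ∀ j, slideRegion k F i j → val k F i j = k → F (i, j) = some (.primed k) := by
        intro j z a
        rcases hcells i j z with e | h
        · exact e
        · have := val_lt_iff.2 h
          omega
      have := (H.row _ _ _ _ _ z₁.1 h (e _ z₁ a₁) (e _ z₂ a₂)).2 rfl
      simp only [Letter.rank] at this
      omega
    have := key j₁ j₂ z₁ z₂ a₁ a₂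
    have := key j₂ j₁ z₂ z₁ a₂ a₁
    omega
  · intro i _
    refine val_eq_of_not_slideRegion (le_max_right _ _) fun h => ?_
    have := hB _ _ h
    omega

theorem OnShape.rank_le (H : OnShape k Z F) {i j : ℕ} {x : Letter} (hz : Z i j)
    (hx : F (i, j) = some x) : x.rank ≤ 2 * k := by
  rcases H.cells i j hz with e | ⟨b, hb, e⟩ <;> rw [hx] at e <;> cases e <;>
    simp only [Letter.rank] <;> omega

theorem OnShape.isSome (H : OnShape k Z F) {i j : ℕ} (hz : Z i j) : (F (i, j)).isSome := by
  rcases H.cells i j hz with e | ⟨b, hb, e⟩ <;> rw [e] <;> rfl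

theorem AgreeOff.isSome_iff (h : AgreeOff Z G F) (hF : OnShape k Z F) (hG : OnShape k Z G)
    (c : ℕ × ℕ) : (G c).isSome ↔ (F c).isSome := by
  obtain ⟨i, j⟩ := c
  by_cases hz : Z i j
  · simp [hF.isSome hz, hG.isSome hz]
  · rw [h i j hz]

theorem AgreeOff.isShiftedFilling (h : AgreeOff Z G F) (hF : OnShape k Z F) (hG : OnShape k Z G)
    (hk : k < n) (H : IsShiftedFilling n mu F) : IsShiftedFilling n mu G := by
  refine ⟨fun c => (h.isSome_iff hF hG c).trans (H.shape c), ?_⟩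
  rintro ⟨i, j⟩ x hx
  by_cases hz : Z i j
  · have := hG.rank_le hz hx
    rw [← Letter.rank_div_two]
    omega
  · rw [h i j hz] at hx
    exact H.bound _ _ hx

/-- A filling at stage `k` in which all letters `k'` have been slid is at stage `k + 1`. -/
theorem IsStage.succ (hmu : IsWideShape n mu l) (H : IsStage n mu k F) (hk : k < n)
    (hG : IsSettled k r n (slideRegion k F) G) (h : AgreeOff (slideRegion k F) G F) :
    IsStage n mu (k + 1) G := by
  have hZ := H.isSlideShape hmu hk
  have hF := H.isSettled hmu hk
  have hcell : ∀ i j, k + 1 ≤ j → slideRegion k F i j →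
      G (i, j) = some (.unprimed (val k G i j)) ∧ val k G i j < k := by
    intro i j hj hz
    have hlt : val k G i j < k := by
      have := hG.2.holes i j hz
      have := hG.2.le i j
      have := hZ.row_le _ _ hz
      omega
    exact ⟨hG.1.eq_unprimed hz hlt, hlt⟩
  refine ⟨h.isShiftedFilling hF.1 hG.1 hk H.toIsShiftedFilling, ?_, ?_, ?_, ?_, ?_⟩
  · intro i j b hj hb
    by_cases hz : slideRegion k F i j
    · have := hz.1
      obtain rfl : j = k := by omega
      have hr := hG.1.rank_le hz hb
      have := hG.2.final_of_le hZ hk i (hZ.row_le _ _ hz)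
      rw [val_unprimed hb] at this
      simp only [Letter.rank] at hr
      omega
    · rw [h i j hz] at hb
      rcases Nat.lt_succ_iff_lt_or_eq.1 hj with hj | rfl
      · exact H.left_unprimed i j b hj hb
      · have h1 := H.cell hmu hb
        have h2 : ¬ i < j := fun h2 => hz (hZ.full i h2)
        obtain rfl : i = j := by omega
        exact (H.diag_index hmu le_rfl hb).symm
  · intro i j b hj hb
    by_cases hz : slideRegion k F i j
    · have := hz.1
      rcases hG.1.cells i j hz with e | ⟨b, hb', e⟩ <;> rw [hb] at e <;> cases e
      omega
    · rw [h i j hz] at hb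
      rcases Nat.lt_succ_iff_lt_or_eq.1 hj with hj | rfl
      · exact H.left_primed i j b hj hb
      · have h1 := H.cell hmu hb
        have h2 : ¬ i < j := fun h2 => hz (hZ.full i h2)
        obtain rfl : i = j := by omega
        exact (H.diag_index hmu le_rfl hb).symm
  · intro i j b hj hb
    by_cases hz : slideRegion k F i j
    · rw [(hcell i j hj hz).1] at hb
      cases hb
    · rw [h i j hz] at hb
      have := lt_rank_of_not_slideRegion (by omega) hz hb
      simp only [Letter.rank] at this
      omega
  · intro i j₁ j₂ x y hj hjj hx hy
    by_cases z₁ : slideRegion k F i j₁ <;> by_cases z₂ : slideRegion k F i j₂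
    · have := hG.2.row i j₁ j₂ (by omega) hjj (by omega)
      rw [(hcell i j₁ hj z₁).1] at hx
      rw [(hcell i j₂ (by omega) z₂).1] at hy
      cases hx; cases hy
      simp only [Letter.rank]
      omega
    · have h1 := hG.1.rank_le z₁ hx
      rw [h _ _ z₂] at hy
      have h2 := lt_rank_of_not_slideRegion (by omega) z₂ hy
      omega
    · exact absurd (hZ.closed _ _ _ _ z₂ le_rfl (by omega) hjj.le) z₁
    · rw [h _ _ z₁] at hx
      rw [h _ _ z₂] at hy
      exact H.row _ _ _ _ _ (by omega) hjj hx hy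
  · intro i₁ i₂ j x y hj hii hx hy
    by_cases z₁ : slideRegion k F i₁ j <;> by_cases z₂ : slideRegion k F i₂ j
    · have := hG.2.col i₁ i₂ j (by omega) hii (by omega)
      have := (hcell i₂ j hj z₂).2
      rw [(hcell i₁ j hj z₁).1] at hx
      rw [(hcell i₂ j hj z₂).1] at hy
      cases hx; cases hy
      simp only [Letter.rank]
      omega
    · have h1 := hG.1.rank_le z₁ hx
      rw [h _ _ z₂] at hy
      have h2 := lt_rank_of_not_slideRegion (by omega) z₂ hy
      omega
    · exact absurd (hZ.closed _ _ _ _ z₂ hii.le (by omega) le_rfl) z₁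
    · rw [h _ _ z₁] at hx
      rw [h _ _ z₂] at hy
      exact H.col _ _ _ _ _ (by omega) hii hx hy

theorem IsStage.col_eq (H : IsStage n mu (k + 1) G) {i : ℕ} {x : Letter}
    (hx : G (i, k) = some x) : x = .primed k ∨ x = .unprimed i := by
  rcases x with b | b
  · left; rw [H.left_primed _ _ _ (Nat.lt_succ_self k) hx]
  · right; rw [H.left_unprimed _ _ _ (Nat.lt_succ_self k) hx]

/-- At stage `k + 1`, the region of the letters at most `k'` contains only unprimed letters to the
right of column `k`. -/
theorem IsStage.slideRegion_pred (hmu : IsWideShape n mu l) (H : IsStage n mu (k + 1) G)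
    {i j : ℕ} (hz : slideRegion k G i j) (hj : k < j) :
    ∃ b < k, G (i, j) = some (.unprimed b) ∧ i ≤ b := by
  obtain ⟨-, x, hx, hr⟩ := hz
  have h1 := H.row_le_index hmu i j x hj hx
  rcases x with b | b
  · have := H.right_primed _ _ _ hj hx
    simp only [Letter.rank] at hr
    omega
  · simp only [Letter.rank, Letter.index] at hr h1
    exact ⟨b, by omega, hx, h1⟩

theorem IsStage.isSlideShape_pred (hmu : IsWideShape n mu l) (H : IsStage n mu (k + 1) G)
    (hk : k < n) : IsSlideShape k (slideRegion k G) := by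
  have hrow : ∀ i j, slideRegion k G i j → i ≤ k := by
    intro i j hz
    rcases hz.1.eq_or_lt with rfl | hj
    · obtain ⟨-, x, hx, hr⟩ := hz
      exact (H.cell hmu hx).2.1
    · obtain ⟨b, hb, -, h⟩ := H.slideRegion_pred hmu hz hj
      omega
  have hfull : ∀ i, i < k → slideRegion k G i k := by
    intro i hi
    obtain ⟨x, hx⟩ := H.exists_letter hmu (i := i) (j := k) (by omega) (by omega) (by omega)
    refine ⟨le_rfl, x, hx, ?_⟩
    rcases H.col_eq hx with rfl | rfl <;> simp only [Letter.rank] <;> omega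
  refine ⟨?_, fun i j h => h.1, hrow, hfull, n + l 0, ?_⟩
  · rintro i j i' j' h hi hj hj'
    have hik := hrow i j h
    have hx := h
    obtain ⟨-, x, hx, hr⟩ := hx
    rcases hj.eq_or_lt with rfl | hj
    · rcases (hi.trans hik).eq_or_lt with rfl | hi'
      · rcases hj'.eq_or_lt with rfl | hj'
        · obtain rfl := le_antisymm hi hik
          exact h
        · obtain ⟨b, hb, -, hib⟩ := H.slideRegion_pred hmu h hj'
          omega
      · exact hfull _ hi'
    obtain ⟨y, hy⟩ := H.exists_letter_of_le hmu hx hi le_rfl (by omega)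
    obtain ⟨z, hz⟩ := H.exists_letter_of_le hmu hx hi hj' (by omega)
    refine ⟨hj.le, z, hz, ?_⟩
    have h1 : z.rank ≤ y.rank := by
      rcases hj'.eq_or_lt with rfl | h
      · rw [hy] at hz; cases hz; rfl
      · exact (H.row _ _ _ _ _ hj h hz hy).1
    have h2 : y.rank ≤ x.rank := by
      rcases hi.eq_or_lt with rfl | h
      · rw [hy] at hx; cases hx; rfl
      · exact (H.col _ _ _ _ _ (by omega) h hy hx).1
    omega
  · rintro i j ⟨-, x, hx, -⟩
    have := H.cell hmu hx
    have := hmu.anti (Nat.zero_le i)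
    omega

theorem IsStage.isSettled_pred (hmu : IsWideShape n mu l) (H : IsStage n mu (k + 1) G)
    (hk : k < n) : IsSettled k (k + 1) n (slideRegion k G) G := by
  have hZ := H.isSlideShape_pred hmu hk
  have hcol : ∀ i, val k G i k = i ∨ val k G i k = k := by
    intro i
    rcases e : G (i, k) with _ | x
    · simp [val, e]
    · rcases H.col_eq e with rfl | rfl
      · exact Or.inr (val_primed e)
      · rw [val_unprimed e]; omega
  refine ⟨⟨?_, ?_⟩, val_le k G, fun i j => val_eq_of_not_slideRegion, ?_, fun i _ => hcol i, ?_, ?_,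
    hk, ?_, ?_, k, fun _ => 0, le_rfl, ?_, ?_, ?_, ?_⟩
  · intro i j hz
    rcases hz.1.eq_or_lt with rfl | hj
    · obtain ⟨-, x, hx, hr⟩ := hz
      rcases H.col_eq hx with rfl | rfl
      · exact Or.inl hx
      · simp only [Letter.rank] at hr
        exact Or.inr ⟨i, by omega, hx⟩
    · obtain ⟨b, hb, h, -⟩ := H.slideRegion_pred hmu hz hj
      exact Or.inr ⟨b, hb, h⟩
  · intro i j h
    have hj : k ≤ j := by
      by_contra hj
      have := H.left_primed i j k (by omega) h
      omega
    exact ⟨hj, _, h, by simp [Letter.rank]⟩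
  · intro i j hj hi
    rcases hj.eq_or_lt with rfl | hj
    · have := hcol i
      omega
    · by_contra h
      obtain ⟨b, hb, e⟩ := val_lt_iff.1 (show val k G i j < k by omega)
      have := H.row_le_index hmu i j _ hj e
      rw [val_unprimed e] at h
      simp only [Letter.index] at this
      omega
  · intro i j₁ j₂ hj hjj hi
    by_contra h
    have := val_le k G i j₁
    have z₂ : slideRegion k G i j₂ := by
      by_contra hz
      have := val_eq_of_not_slideRegion (by omega) hz
      omega
    have := hZ.row_le _ _ z₂
    have hj' : k < j₁ := by omega
    obtain ⟨b, hb, e, -⟩ := H.slideRegion_pred hmu z₂ (by omega)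
    obtain ⟨b', hb', e', -⟩ := H.slideRegion_pred hmu (hZ.closed _ _ _ _ z₂ le_rfl hj hjj.le) hj'
    have := H.row _ _ _ _ _ hj' hjj e' e
    rw [val_unprimed e, val_unprimed e'] at h
    simp only [Letter.rank] at this
    omega
  · intro i₁ i₂ j hj hii hi
    by_contra h
    have := val_le k G i₂ j
    have z₂ : slideRegion k G i₂ j := by
      by_contra hz
      have := val_eq_of_not_slideRegion (by omega) hz
      omega
    have := hZ.row_le _ _ z₂
    have hj' : k < j := by omega
    obtain ⟨b, hb, e, -⟩ := H.slideRegion_pred hmu z₂ (by omega)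
    obtain ⟨b', hb', e', -⟩ := H.slideRegion_pred hmu (hZ.closed _ _ _ _ z₂ hii.le hj le_rfl) hj'
    have := H.col _ _ _ _ _ hj' hii e' e
    rw [val_unprimed e, val_unprimed e'] at h
    simp only [Letter.rank] at this
    omega
  · intro i j hz ha
    left
    rcases hz.1.eq_or_lt with rfl | hj
    · have := hZ.row_le _ _ hz
      omega
    · obtain ⟨b, hb, e, -⟩ := H.slideRegion_pred hmu hz hj
      rw [val_unprimed e] at ha
      omega
  · intro i j₁ j₂ hi z₁
    have := hZ.row_le _ _ z₁
    omega
  · intro i hi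
    refine val_eq_of_not_slideRegion le_rfl fun hz => ?_
    have := hZ.row_le _ _ hz
    omega
  · intros; omega
  · intros; omega
  · intros; omega

/-- A filling at stage `k + 1` in which all letters `k'` have been slid back is at stage `k`. -/
theorem IsStage.pred (hmu : IsWideShape n mu l) (H : IsStage n mu (k + 1) G) (hk : k < n)
    (hF : IsSettled k 0 0 (slideRegion k G) F) (h : AgreeOff (slideRegion k G) F G) :
    IsStage n mu k F := by
  have hZ := H.isSlideShape_pred hmu hk
  have hG := H.isSettled_pred hmu hk
  -- the only cell of column `k` that may lie outside the region is the diagonal one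
  have hdiag : ∀ i x, ¬ slideRegion k G i k → G (i, k) = some x → i = k ∧ x.rank = 2 * k + 1 := by
    intro i x hz hx
    have h1 := H.cell hmu hx
    have h2 : ¬ i < k := fun h2 => hz (hZ.full i h2)
    have hi : i = k := by omega
    refine ⟨hi, ?_⟩
    have h3 := lt_rank_of_not_slideRegion le_rfl hz hx
    rcases H.col_eq hx with rfl | rfl <;> simp only [Letter.rank] at * <;> omega
  refine ⟨h.isShiftedFilling hG.1 hF.1 hk H.toIsShiftedFilling, ?_, ?_, ?_, ?_, ?_⟩
  · intro i j b hj hb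
    rw [h i j fun hz => by have := hz.1; omega] at hb
    exact H.left_unprimed i j b (by omega) hb
  · intro i j b hj hb
    rw [h i j fun hz => by have := hz.1; omega] at hb
    exact H.left_primed i j b (by omega) hb
  · intro i j b hj hb
    by_cases hz : slideRegion k G i j
    · rcases hF.1.cells i j hz with e | ⟨b, hb', e⟩ <;> rw [hb] at e <;> cases e
      omega
    · rw [h i j hz] at hb
      have := lt_rank_of_not_slideRegion (by omega) hz hb
      simp only [Letter.rank] at this
      omega
  · intro i j₁ j₂ x y hj hjj hx hy
    by_cases z₁ : slideRegion k G i j₁ <;> by_cases z₂ : slideRegion k G i j₂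
    · have h0 := hF.2.row i j₁ j₂ (by omega) hjj (by omega)
      rcases hF.1.cells _ _ z₁ with e | ⟨b, hb, e⟩ <;>
      rcases hF.1.cells _ _ z₂ with e' | ⟨b', hb', e'⟩
      · have := hF.2.single i j₁ j₂ (by omega) z₁ z₂ (val_primed e) (val_primed e')
        omega
      · rw [val_primed e, val_unprimed e'] at h0
        omega
      · rw [e] at hx; rw [e'] at hy; cases hx; cases hy
        simp only [Letter.rank]; omega
      · rw [val_unprimed e, val_unprimed e'] at h0
        rw [e] at hx; rw [e'] at hy; cases hx; cases hy
        simp only [Letter.rank]; omega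
    · have h1 := hF.1.rank_le z₁ hx
      rw [h _ _ z₂] at hy
      have h2 := lt_rank_of_not_slideRegion (by omega) z₂ hy
      omega
    · exact absurd (hZ.closed _ _ _ _ z₂ le_rfl (by omega) hjj.le) z₁
    · rw [h _ _ z₁] at hx
      rw [h _ _ z₂] at hy
      rcases hj.eq_or_lt with rfl | hj
      · have h1 := hdiag i x z₁ hx
        have h2 := lt_rank_of_not_slideRegion (by omega) z₂ hy
        omega
      · exact H.row _ _ _ _ _ hj hjj hx hy
  · intro i₁ i₂ j x y hj hii hx hy
    by_cases z₁ : slideRegion k G i₁ j <;> by_cases z₂ : slideRegion k G i₂ j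
    · have h0 := hF.2.col i₁ i₂ j (by omega) hii (by omega)
      rcases hF.1.cells _ _ z₁ with e | ⟨b, hb, e⟩ <;>
      rcases hF.1.cells _ _ z₂ with e' | ⟨b', hb', e'⟩
      · rw [e] at hx; rw [e'] at hy; cases hx; cases hy
        simp only [Letter.rank]; omega
      · rw [val_primed e, val_unprimed e'] at h0
        omega
      · rw [e] at hx; rw [e'] at hy; cases hx; cases hy
        simp only [Letter.rank]; omega
      · rw [val_unprimed e, val_unprimed e'] at h0
        rw [e] at hx; rw [e'] at hy; cases hx; cases hy
        simp only [Letter.rank]; omega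
    · have h1 := hF.1.rank_le z₁ hx
      rw [h _ _ z₂] at hy
      have h2 := lt_rank_of_not_slideRegion (by omega) z₂ hy
      omega
    · exact absurd (hZ.closed _ _ _ _ z₂ hii.le (by omega) le_rfl) z₁
    · rw [h _ _ z₁] at hx
      rw [h _ _ z₂] at hy
      rcases hj.eq_or_lt with rfl | hj
      · have h1 := hdiag _ x z₁ hx
        have h2 := hdiag _ y z₂ hy
        omega
      · exact H.col _ _ _ _ _ hj hii hx hy

/-- Only the cell `(k, k)` is both diagonal and in the region, and its letter is too large to be
a small one. -/
theorem IsSettled.diag_eq (H : IsSettled k r I Z F) (hZ : IsSlideShape k Z) {i : ℕ}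
    (hz : Z i i) : F (i, i) = some (.primed k) := by
  have h1 := hZ.row_le _ _ hz
  have h2 := hZ.le_col _ _ hz
  have h3 := H.2.lower i i h2 h1
  have h4 := H.2.le i i
  exact H.1.eq_primed hz (by omega)

theorem theta_bijOn (hmu : IsWideShape n mu l) (hk : k < n) :
    Set.BijOn (theta n k) {F | IsStage n mu k F} {F | IsStage n mu (k + 1) F} := by
  refine ⟨?_, ?_, ?_⟩
  · intro F (H : IsStage n mu k F)
    have hZ := H.isSlideShape hmu hk
    obtain ⟨h1, ⟨r, h2⟩, -⟩ := (H.isSettled hmu hk).theta (n := n) hZ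
    exact H.succ hmu hk h2 h1
  · intro F (H : IsStage n mu k F) F' (H' : IsStage n mu k F') e
    have h := ((H.isSettled hmu hk).theta (n := n) (H.isSlideShape hmu hk)).2.2
    have h' := ((H'.isSettled hmu hk).theta (n := n) (H'.isSlideShape hmu hk)).2.2
    rw [e] at h
    exact h.unique _ _ h'
  · intro G (H : IsStage n mu (k + 1) G)
    obtain ⟨E, h1, h2, h3⟩ := IsSettled.exists_foldl_eq (H.isSlideShape_pred hmu hk) (k + 1) n G
      le_rfl (H.isSettled_pred hmu hk)
    exact ⟨E, H.pred hmu hk h1 fun i j hz => (h3 i j hz).symm, h2⟩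

theorem IsStage.theta_diag (hmu : IsWideShape n mu l) (H : IsStage n mu k F) (hk : k < n)
    (i : ℕ) : theta n k F (i, i) = F (i, i) := by
  have hZ := H.isSlideShape hmu hk
  have h0 := H.isSettled hmu hk
  obtain ⟨h1, ⟨r, h2⟩, -⟩ := h0.theta (n := n) hZ
  by_cases hz : slideRegion k F i i
  · rw [h0.diag_eq hZ hz, h2.diag_eq hZ hz]
  · exact h1 i i hz

end

/-! ### Tableaux, weights and juxtaposition -/

section

variable {n k : ℕ} {mu l : ℕ → ℕ} {F : Filling}

theorem isStage_zero_iff : IsStage n mu 0 F ↔ IsQST n mu F := by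
  constructor
  · intro H
    refine ⟨H.toIsShiftedFilling, ?_, ?_, ?_, ?_⟩
    · intro i j₁ j₂ x y h hx hy
      exact (H.row i j₁ j₂ x y (by omega) h hx hy).1
    · intro i₁ i₂ j x y h hx hy
      exact (H.col i₁ i₂ j x y (by omega) h hx hy).1
    · intro i₁ i₂ j b hx hy
      rcases lt_trichotomy i₁ i₂ with h | h | h
      · have := (H.col _ _ _ _ _ (by omega) h hx hy).2 rfl
        simp only [Letter.rank] at this
        omega
      · exact h
      · have := (H.col _ _ _ _ _ (by omega) h hy hx).2 rfl
        simp only [Letter.rank] at this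
        omega
    · intro i j₁ j₂ b hx hy
      rcases lt_trichotomy j₁ j₂ with h | h | h
      · have := (H.row _ _ _ _ _ (by omega) h hx hy).2 rfl
        simp only [Letter.rank] at this
        omega
      · exact h
      · have := (H.row _ _ _ _ _ (by omega) h hy hx).2 rfl
        simp only [Letter.rank] at this
        omega
  · intro H
    refine ⟨H.toIsShiftedFilling, by omega, by omega, by omega, ?_, ?_⟩
    · intro i j₁ j₂ x y _ h hx hy
      refine ⟨H.row_weak i j₁ j₂ x y h hx hy, fun e => ?_⟩
      obtain rfl := Letter.rank_injective e
      rcases x with b | b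
      · have := H.row_primed i j₁ j₂ b hx hy
        omega
      · simp only [Letter.rank]; omega
    · intro i₁ i₂ j x y _ h hx hy
      refine ⟨H.col_weak i₁ i₂ j x y h hx hy, fun e => ?_⟩
      obtain rfl := Letter.rank_injective e
      rcases x with b | b
      · simp only [Letter.rank]; omega
      · have := H.col_unprimed i₁ i₂ j b hx hy
        omega

theorem foldl_theta_bijOn (hmu : IsWideShape n mu l) {m : ℕ} (hm : m ≤ n) :
    Set.BijOn (fun F => (List.range m).foldl (fun G k => theta n k G) F)
      {F | IsStage n mu 0 F} {F | IsStage n mu m F} := by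
  induction m with
  | zero => exact Set.bijOn_id _
  | succ m ih =>
    refine ((theta_bijOn hmu hm).comp (ih (by omega))).congr fun F _ => ?_
    simp [List.range_succ]

theorem jeuDeTaquin_bijOn (hmu : IsWideShape n mu l) :
    Set.BijOn (jeuDeTaquin n) (QST n mu) {F | IsStage n mu n F} := by
  have h : QST n mu = {F | IsStage n mu 0 F} := Set.ext fun F => isStage_zero_iff.symm
  rw [h]
  exact foldl_theta_bijOn hmu le_rfl

theorem jeuDeTaquin_diag (hmu : IsWideShape n mu l) (H : IsQST n mu F) (i : ℕ) :
    jeuDeTaquin n F (i, i) = F (i, i) := by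
  have key : ∀ m ≤ n, (List.range m).foldl (fun G k => theta n k G) F (i, i) = F (i, i) := by
    intro m hm
    induction m with
    | zero => rfl
    | succ m ih =>
      have hs : IsStage n mu m ((List.range m).foldl (fun G k => theta n k G) F) :=
        (foldl_theta_bijOn hmu (by omega)).mapsTo (isStage_zero_iff.2 H)
      rw [List.range_succ, List.foldl_append, List.foldl_cons, List.foldl_nil,
        hs.theta_diag hmu (by omega), ih (by omega)]
  exact key n le_rfl

theorem exists_perm_slide (k : ℕ) (F : Filling) (c : ℕ × ℕ) :
    ∃ e : Equiv.Perm (ℕ × ℕ), slide k F c = F ∘ e := by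
  have key : ∀ m, ∃ e : Equiv.Perm (ℕ × ℕ), ((move k)^[m] (F, c)).1 = F ∘ e := by
    intro m
    induction m with
    | zero => exact ⟨Equiv.refl _, rfl⟩
    | succ m ih =>
      obtain ⟨e, he⟩ := ih
      rw [Function.iterate_succ_apply', move]
      split
      · rw [he]
        exact ⟨(Equiv.swap _ _).trans e, rfl⟩
      · exact ⟨e, he⟩
  exact key _

theorem exists_perm_foldl {α : Type*} {f : Filling → α → Filling}
    (hf : ∀ F a, ∃ e : Equiv.Perm (ℕ × ℕ), f F a = F ∘ e) (L : List α) (F : Filling) :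
    ∃ e : Equiv.Perm (ℕ × ℕ), L.foldl f F = F ∘ e := by
  induction L generalizing F with
  | nil => exact ⟨Equiv.refl _, rfl⟩
  | cons a L ih =>
    obtain ⟨e, he⟩ := hf F a
    obtain ⟨e', he'⟩ := ih (f F a)
    refine ⟨e'.trans e, ?_⟩
    rw [List.foldl_cons, he', he]
    rfl

theorem exists_perm_jeuDeTaquin (n : ℕ) (F : Filling) :
    ∃ e : Equiv.Perm (ℕ × ℕ), jeuDeTaquin n F = F ∘ e := by
  refine exists_perm_foldl (fun F k => exists_perm_foldl (fun F i => ?_) _ F) _ F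
  unfold slideRow
  split
  · exact exists_perm_slide _ _ _
  · exact ⟨Equiv.refl _, rfl⟩

theorem wgt_comp_perm (n : ℕ) (F : Filling) (e : Equiv.Perm (ℕ × ℕ)) :
    wgt n (F ∘ e) = wgt n F := by
  have h : ∀ x, {c | (F ∘ e) c = some x}.ncard = {c | F c = some x}.ncard := fun x =>
    Set.ncard_preimage_of_injective_subset_range (s := {c | F c = some x}) e.injective
      (by simp [e.surjective.range_eq])
  simp only [wgt, h]

variable {lam : YoungDiagram}

theorem isWideShape (hlam : lam.colLen 0 ≤ n) :
    IsWideShape n (fun i => lam.rowLen i + delta n i) lam.rowLen := by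
  refine ⟨fun i j => ?_, fun i j h => lam.rowLen_anti i j h⟩
  have h : n ≤ i → lam.rowLen i = 0 := by
    intro hi
    by_contra h
    have h1 := YoungDiagram.mem_iff_lt_rowLen.2 (Nat.pos_of_ne_zero h)
    have h2 := YoungDiagram.mem_iff_lt_colLen.1 h1
    omega
  simp only [shiftedDiagram, delta, Set.mem_ofPred_eq]
  omega

theorem IsQD.lt (H : IsQD n F) {i j : ℕ} {x : Letter} (h : F (i, j) = some x) :
    i ≤ j ∧ j < n := by
  have := (H.shape (i, j)).1 (by rw [h]; rfl)
  simp only [shiftedDiagram, delta, Set.mem_ofPred_eq] at this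
  omega

theorem IsQD.eq_none (H : IsQD n F) {i j : ℕ} (h : n ≤ j) : F (i, j) = none := by
  rcases e : F (i, j) with _ | x
  · rfl
  · have := H.lt e
    omega

theorem juxtapose_left {D : Filling} {T : SemistandardYoungTableau lam} {i j : ℕ} (h : j < n) :
    juxtapose n D T (i, j) = D (i, j) := if_pos h

theorem juxtapose_right {D : Filling} {T : SemistandardYoungTableau lam} {i j : ℕ}
    (h : (i, j) ∈ lam) : juxtapose n D T (i, n + j) = some (.unprimed (T i j)) := by
  simp [juxtapose, h]

theorem juxtapose_right_eq_some {D : Filling} {T : SemistandardYoungTableau lam} {i j : ℕ}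
    {x : Letter} (hj : n ≤ j) (h : juxtapose n D T (i, j) = some x) :
    (i, j - n) ∈ lam ∧ x = .unprimed (T i (j - n)) := by
  simp only [juxtapose, if_neg (not_lt.2 hj)] at h
  split_ifs at h with h'
  · exact ⟨h', by cases h; rfl⟩

theorem isStage_juxtapose (hlam : lam.colLen 0 ≤ n) {D : Filling} (hD : IsQD n D)
    {T : SemistandardYoungTableau lam} (hT : T ∈ SST n lam) :
    IsStage n (fun i => lam.rowLen i + delta n i) n (juxtapose n D T) := by
  refine ⟨⟨?_, ?_⟩, ?_, ?_, ?_, ?_, ?_⟩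
  · rintro ⟨i, j⟩
    rw [(isWideShape hlam).mem]
    rcases lt_or_ge j n with h | h
    · rw [juxtapose_left h, hD.shape]
      simp only [shiftedDiagram, delta, Set.mem_ofPred_eq]
      omega
    · obtain ⟨j, rfl⟩ := Nat.exists_eq_add_of_le h
      by_cases hm : (i, j) ∈ lam
      · have h1 := YoungDiagram.mem_iff_lt_rowLen.1 hm
        have h2 := YoungDiagram.mem_iff_lt_colLen.1 hm
        have h3 := lam.colLen_anti 0 j (Nat.zero_le j)
        rw [juxtapose_right hm]
        simp only [Option.isSome_some, true_iff]
        omega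
      · have h1 := mt YoungDiagram.mem_iff_lt_rowLen.2 hm
        simp only [juxtapose, if_neg (not_lt.2 h), Nat.add_sub_cancel_left, if_neg hm,
          Option.isSome_none]
        constructor
        · intro h; cases h
        · omega
  · rintro ⟨i, j⟩ x hx
    rcases lt_or_ge j n with h | h
    · rw [juxtapose_left h] at hx
      exact hD.bound _ _ hx
    · obtain ⟨hm, rfl⟩ := juxtapose_right_eq_some h hx
      exact hT (i, j - n) hm
  · intro i j b h hx
    rw [juxtapose_left h] at hx
    exact hD.unprimed_row _ _ _ hx
  · intro i j b h hx
    rw [juxtapose_left h] at hx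
    exact hD.primed_col _ _ _ hx
  · intro i j b h hx
    cases (juxtapose_right_eq_some h hx).2
  · intro i j₁ j₂ x y h hj hx hy
    obtain ⟨h1, rfl⟩ := juxtapose_right_eq_some h hx
    obtain ⟨h2, rfl⟩ := juxtapose_right_eq_some (by omega) hy
    have := T.row_weak (show j₁ - n < j₂ - n by omega) h2
    simp only [Letter.rank]
    omega
  · intro i₁ i₂ j x y h hi hx hy
    obtain ⟨h1, rfl⟩ := juxtapose_right_eq_some h hx
    obtain ⟨h2, rfl⟩ := juxtapose_right_eq_some h hy
    have := T.col_strict hi h2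
    simp only [Letter.rank]
    omega

theorem juxtapose_injective {D D' : Filling} (hD : IsQD n D) (hD' : IsQD n D')
    {T T' : SemistandardYoungTableau lam} (h : juxtapose n D T = juxtapose n D' T') :
    D = D' ∧ T = T' := by
  constructor
  · funext ⟨i, j⟩
    rcases lt_or_ge j n with hj | hj
    · rw [← juxtapose_left (D := D) (T := T) hj, h, juxtapose_left hj]
    · rw [hD.eq_none hj, hD'.eq_none hj]
  · ext i j
    by_cases hm : (i, j) ∈ lam
    · have := congrFun h (i, n + j)
      rw [juxtapose_right hm, juxtapose_right hm] at this
      simpa using this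
    · rw [T.zeros hm, T'.zeros hm]

theorem IsStage.exists_juxtapose (hlam : lam.colLen 0 ≤ n)
    (H : IsStage n (fun i => lam.rowLen i + delta n i) n F) :
    ∃ D ∈ QD n, ∃ T ∈ SST n lam, juxtapose n D T = F := by
  have hmu := isWideShape hlam
  have hcell : ∀ i j, (i, j) ∈ lam → F (i, n + j) = some (.unprimed (val n F i (n + j))) ∧
      val n F i (n + j) < n := by
    intro i j hm
    have h1 := YoungDiagram.mem_iff_lt_rowLen.1 hm
    have h2 := YoungDiagram.mem_iff_lt_colLen.1 hm
    have h3 := lam.colLen_anti 0 j (Nat.zero_le j)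
    obtain ⟨x, hx⟩ := H.exists_letter hmu (i := i) (j := n + j) (by omega) (by omega) (by omega)
    have hb := H.bound _ _ hx
    rcases x with b | b
    · have := H.right_primed _ _ _ (by omega) hx
      simp only [Letter.index] at hb
      omega
    · simp only [Letter.index] at hb
      rw [val_unprimed hx, min_eq_left hb.le]
      exact ⟨hx, hb⟩
  let T : SemistandardYoungTableau lam :=
    { entry := fun i j => if (i, j) ∈ lam then val n F i (n + j) else 0
      row_weak' := by
        intro i j₁ j₂ hj hm
        have hm' := lam.up_left_mem le_rfl hj.le hm
        have := H.row i (n + j₁) (n + j₂) _ _ (by omega) (by omega) (hcell _ _ hm').1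
          (hcell _ _ hm).1
        simp only [Letter.rank] at this
        rw [if_pos hm', if_pos hm]
        omega
      col_strict' := by
        intro i₁ i₂ j hi hm
        have hm' := lam.up_left_mem hi.le le_rfl hm
        have := H.col i₁ i₂ (n + j) _ _ (by omega) hi (hcell _ _ hm').1 (hcell _ _ hm).1
        simp only [Letter.rank] at this
        rw [if_pos hm', if_pos hm]
        omega
      zeros' := fun hm => if_neg hm }
  have hT : ∀ i j, (i, j) ∈ lam → T i j = val n F i (n + j) := fun i j hm => if_pos hm
  refine ⟨fun c => if c.2 < n then F c else none, ⟨⟨?_, ?_⟩, ?_, ?_⟩, T, ?_, ?_⟩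
  · rintro ⟨i, j⟩
    by_cases hj : j < n
    · rw [if_pos hj, H.shape, hmu.mem]
      simp only [shiftedDiagram, delta, Set.mem_ofPred_eq]
      omega
    · rw [if_neg hj]
      simp only [shiftedDiagram, delta, Set.mem_ofPred_eq, Option.isSome_none]
      constructor
      · intro h; cases h
      · omega
  · intro c x hx
    split_ifs at hx
    exact H.bound _ _ hx
  · intro i j b hx
    split_ifs at hx with hj
    exact H.left_unprimed _ _ _ hj hx
  · intro i j b hx
    split_ifs at hx with hj
    exact H.left_primed _ _ _ hj hx
  · rintro ⟨i, j⟩ hm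
    rw [hT i j hm]
    exact (hcell i j hm).2
  · funext ⟨i, j⟩
    rcases lt_or_ge j n with hj | hj
    · rw [juxtapose_left hj, if_pos hj]
    · obtain ⟨j, rfl⟩ := Nat.exists_eq_add_of_le hj
      by_cases hm : (i, j) ∈ lam
      · rw [juxtapose_right hm, hT i j hm, (hcell i j hm).1]
      · have h1 := mt YoungDiagram.mem_iff_lt_rowLen.2 hm
        have h2 : ¬ (F (i, n + j)).isSome := by
          rw [H.shape, hmu.mem]
          omega
        rw [Option.not_isSome_iff_eq_none.1 h2]
        simp [juxtapose, hm]

theorem wgt_juxtapose {D : Filling} (hD : IsQD n D) (T : SemistandardYoungTableau lam) :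
    wgt n (juxtapose n D T) = wgt n D + (wgtSST n T, 0) := by
  refine Prod.ext (funext fun k => ?_) (funext fun k => ?_)
  · have hfin : {c | D c = some (.unprimed k)}.Finite := by
      refine (Finset.range n ×ˢ Finset.range n).finite_toSet.subset ?_
      rintro ⟨i, j⟩ hc
      have := hD.lt hc
      simp only [Finset.coe_product, Finset.coe_range, Set.mem_prod, Set.mem_Iio]
      omega
    have hinj : Function.Injective fun c : ℕ × ℕ => (c.1, n + c.2) := by
      rintro ⟨i, j⟩ ⟨i', j'⟩ h
      simpa using h
    have hset : {c | juxtapose n D T c = some (.unprimed k)} = {c | D c = some (.unprimed k)} ∪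
        (fun c : ℕ × ℕ => (c.1, n + c.2)) '' ↑(lam.cells.filter fun c => T c.1 c.2 = k) := by
      ext ⟨i, j⟩
      simp only [Set.mem_ofPred_eq, Set.mem_union, Set.mem_image, Finset.coe_filter,
        YoungDiagram.mem_cells, Prod.mk.injEq, Prod.exists]
      constructor
      · intro h
        rcases lt_or_ge j n with hj | hj
        · rw [juxtapose_left hj] at h
          exact Or.inl h
        · obtain ⟨h1, h2⟩ := juxtapose_right_eq_some hj h
          refine Or.inr ⟨i, j - n, ⟨h1, ?_⟩, rfl, by omega⟩
          simpa using h2.symm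
      · rintro (h | ⟨i, j, ⟨h1, h2⟩, rfl, rfl⟩)
        · rw [juxtapose_left (hD.lt h).2, h]
        · rw [juxtapose_right h1, h2]
    have hdisj : Disjoint {c | D c = some (.unprimed (k : ℕ))}
        ((fun c : ℕ × ℕ => (c.1, n + c.2)) '' ↑(lam.cells.filter fun c => T c.1 c.2 = k)) := by
      rw [Set.disjoint_left]
      rintro _ h ⟨⟨i, j⟩, -, rfl⟩
      have := hD.lt h
      omega
    change Set.ncard _ = Set.ncard _ + Finset.card _
    rw [hset, Set.ncard_union_eq hdisj hfin ((Finset.finite_toSet _).image _),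
      Set.ncard_image_of_injective _ hinj, Set.ncard_coe_finset]
  · change Set.ncard _ = Set.ncard _ + 0
    congr 1
    ext ⟨i, j⟩
    rcases lt_or_ge j n with hj | hj
    · simp only [Set.mem_ofPred_eq, juxtapose_left hj]
    · simp only [Set.mem_ofPred_eq, hD.eq_none hj, reduceCtorEq, iff_false]
      intro h
      cases (juxtapose_right_eq_some hj h).2

end

end ShiftedTableaux

theorem mainTheorem1 (n : ℕ) (lam : YoungDiagram) (hlam : lam.colLen 0 ≤ n) :
    ∃ Θ : QST n (fun i => lam.rowLen i + delta n i) → QD n × SST n lam,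
      (∀ F, juxtapose n (Θ F).1.1 (Θ F).2.1 = jeuDeTaquin n F.1) ∧
      (∀ F, wgt n F.1 = wgt n (Θ F).1.1 + (wgtSST n (Θ F).2.1, 0)) ∧
      Function.Bijective Θ ∧
      Set.BijOn Θ {F | F.1 ∈ PST n (fun i => lam.rowLen i + delta n i)}
        {p | p.1.1 ∈ PD n} := by
  have hmu := isWideShape hlam
  have hjdt := jeuDeTaquin_bijOn hmu
  have hex : ∀ F : QST n (fun i => lam.rowLen i + delta n i), ∃ p : QD n × SST n lam,
      juxtapose n p.1.1 p.2.1 = jeuDeTaquin n F.1 := by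
    intro F
    obtain ⟨D, hD, T, hT, h⟩ := IsStage.exists_juxtapose hlam (hjdt.mapsTo F.2)
    exact ⟨(⟨D, hD⟩, ⟨T, hT⟩), h⟩
  -- the juxtaposition determines its two parts
  choose Θ hΘ using hex
  have hbij : Function.Bijective Θ := by
    constructor
    · intro F G h
      refine Subtype.ext (hjdt.injOn F.2 G.2 ?_)
      rw [← hΘ F, ← hΘ G, h]
    · intro p
      obtain ⟨F, hF, h⟩ := hjdt.surjOn (isStage_juxtapose hlam p.1.2 p.2.2)
      refine ⟨⟨F, hF⟩, ?_⟩
      have h' := juxtapose_injective (Θ ⟨F, hF⟩).1.2 p.1.2 ((hΘ ⟨F, hF⟩).trans h)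
      exact Prod.ext (Subtype.ext h'.1) (Subtype.ext h'.2)
  have hdiag : ∀ F : QST n (fun i => lam.rowLen i + delta n i),
      F.1 ∈ PST n (fun i => lam.rowLen i + delta n i) ↔ (Θ F).1.1 ∈ PD n := by
    intro F
    have key : ∀ i k, F.1 (i, i) = some (.primed k) ↔ (Θ F).1.1 (i, i) = some (.primed k) := by
      intro i k
      rw [← jeuDeTaquin_diag hmu F.2 i, ← hΘ F]
      rcases lt_or_ge i n with hi | hi
      · rw [juxtapose_left hi]
      · rw [IsQD.eq_none (Θ F).1.2 hi]
        simp only [reduceCtorEq, iff_false]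
        intro h
        cases (juxtapose_right_eq_some hi h).2
    have key' : UnprimedDiagonal F.1 ↔ UnprimedDiagonal (Θ F).1.1 :=
      forall₂_congr fun i k => not_congr (key i k)
    exact ⟨fun h => ⟨(Θ F).1.2, key'.1 h.2⟩, fun h => ⟨F.2, key'.2 h.2⟩⟩
  refine ⟨Θ, hΘ, fun F => ?_, hbij, fun F hF => (hdiag F).1 hF, hbij.injective.injOn, ?_⟩
  · obtain ⟨e, he⟩ := exists_perm_jeuDeTaquin n F.1
    rw [← wgt_juxtapose (Θ F).1.2, hΘ, he, wgt_comp_perm]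
  · intro p hp
    obtain ⟨F, rfl⟩ := hbij.surjective p
    exact ⟨F, (hdiag F).2 hp, rfl⟩
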